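/- **Setting.** For $v\in\mathbb R^p$ let $\|v\|$ be the Euclidean norm and $v^+$ the coordinatewise positive part; inequalities between vectors are coordinatewise. Let $\mu$ be a probability measure on $\mathbb R^d$ with support $\mathbb R^d$ and $\int\|x\|^2\,d\mu(x)<\infty$, let $A^*\in\mathbb R^{d\times d}$ be invertible with nonnegative entries, and let $B^*\in\mathbb R^{m\times d}$ have rank $d$. Let $x^{(1)},x^{(2)},\dots$ be i.i.d. with law $\mu$ and $y^{(i)}=B^*[(A^*x^{(i)})^++x^{(i)}]$. The $L^2$ output loss is $$L(A,B)=\tfrac12\int\big\|B[(Ax)^++x]-B^*[(A^*x)^++x]\big\|^2\,d\mu(x).$$ Component $j$ is called a *scale component* if the $j$-th row of $A^*$ is $A^*_{jj}$ times the $j$-th standard basis vector. Linear regression (LR) on pairs $(u^{(i)},v^{(i)})_{i\in S}$ means choosing a minimizer $K$ of $\hat R(K)=\frac1{2|S|}\sum_{i\in S}\|Ku^{(i)}-v^{(i)}\|^2$. Each step below uses the first $N$ samples, where $N$ may differ from step to step (in particular, all may equal the same $n$). **General algorithm, with tolerance $\varepsilon>0$.** 1. *(Layer 2 QP/LP.)*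 Let $(\hat C,\hat\Xi)$ be any solution of the QP of minimizing $\frac1{2N}\sum_{i\le N}\|\xi^{(i)}+x^{(i)}-Cy^{(i)}\|^2$ over $C\in\mathbb R^{d\times m}$ and $\xi^{(i)}\ge0$; or let $\hat C$ be any feasible point of the LP $Cy^{(i)}-x^{(i)}\ge0$, $i\le N$, and $\hat\xi^{(i)}=\hat Cy^{(i)}-x^{(i)}$. (For $i>N$ put $\hat\xi^{(i)}=\hat Cy^{(i)}-x^{(i)}$.) 2. *(Layer 2 rescaling.)* For each $j$ let $\hat k_j$ be given by LR of $[\hat Cy^{(i)}]_j$ on $x^{(i)}_j$ over the samples with $x^{(i)}_j<0$; if the optimal regression objective exceeds $\varepsilon$, put $\hat k_j=1$ instead. 3. *(Layer 2 weights.)* $\hat B$ is given by LR of $y^{(i)}$ on $\operatorname{diag}(\hat k)^{-1}\hat Cy^{(i)}$, and $\hat h^{(i)}=\operatorname{diag}(\hat k)^{-1}(\hat\xi^{(i)}+x^{(i)})-x^{(i)}$. 4. *(Layer 1 QP/LP.)* Let $\tilde A$ be the matrix part of any minimizer of the QP of minimizing $\frac1{2N}\sum_{i\le N}\|\phi^{(i)}+Ax^{(i)}-\hat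 h^{(i)}\|^2$ over $A\in\mathbb R^{d\times d}$ and $\phi^{(i)}\ge0$, or any feasible point of the LP $\hat h^{(i)}-Ax^{(i)}\ge0$, $i\le N$. 5. *(Layer 1 rescaling.)* For each $j$ let $\hat\kappa_j$ be given by LR of $[\tilde Ax^{(i)}]_j$ on $\hat h^{(i)}_j$ over the samples with $\hat h^{(i)}_j>0$, and let row $j$ of $\hat A$ be row $j$ of $\tilde A$ divided by $\hat\kappa_j$. (Divisions by $0$ may be given any fixed convention; none of them matters asymptotically.) **Simple algorithm, for $m=d$.** Step 1, then $\hat B=\hat C^{-1}$ and $\hat h^{(i)}=\hat\xi^{(i)}$, then steps 4 and 5. **Theorem (strong consistency).** (a) There is $\varepsilon_0>0$, depending only on $\mu$ and $A^*$, such that for every $m$, every $B^*\in\mathbb R^{m\times d}$ of rank $d$ and every tolerance $\varepsilon\in(0,\varepsilon_0)$ the following holds. Let $\hat A_t,\hat B_t$ $(t\in\mathbb N)$ be outputs of the general algorithm, run with any choice of solutions, with sample sizes all of which tend to infinity as $t\to\infty$. Suppose that the layer 1 scale factors do not degenerate, that is, almost surely, for each $j$, $\hat\kappa_j\ne0$ for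 all large $t$, and moreover $\liminf_{t\to\infty}|\hat\kappa_j|>0$ if $j$ is a scale component. Then $L(\hat A_t,\hat B_t)\to0$ almost surely. (b) If $m=d$ and there are no scale components, then the outputs of the simple algorithm, run with any choice of solutions and with sample sizes all of which tend to infinity, satisfy $L(\hat A_t,\hat B_t)\to0$ almost surely, provided that almost surely, for each $j$, $\hat\kappa_j\neq0$ for all large $t$. -/

import Mathlib

open MeasureTheory ProbabilityTheory Filter Matrix

namespace ResidualUnit

noncomputable section

/-- The squared Euclidean norm of a real vector. -/
def sqNorm {p : ℕ} (v : Fin p → ℝ) : ℝ := ∑ j, v j ^ 2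

/-- The coordinatewise rectifier. -/
def relu {p : ℕ} (v : Fin p → ℝ) : Fin p → ℝ := fun j => max 0 (v j)

/-- The two-layer residual unit with weights `A`, `B`. -/
def residualUnit {d m : ℕ} (A : Matrix (Fin d) (Fin d) ℝ) (B : Matrix (Fin m) (Fin d) ℝ)
    (x : Fin d → ℝ) : Fin m → ℝ :=
  B *ᵥ (relu (A *ᵥ x) + x)

/-- `A` is a scale transformation with respect to the component `j`: its `j`-th row is
`A j j` times the `j`-th standard basis vector. -/
def IsScaleTransformation {d : ℕ} (A : Matrix (Fin d) (Fin d) ℝ) (j : Fin d) : Prop :=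
  A j = A j j • (Pi.single j 1 : Fin d → ℝ)

/-- The `L²` output loss of the weights `A'`, `B'` when the outputs are generated by the
residual unit with weights `A`, `B` and the inputs have law `μ`. -/
def outputLoss {d m : ℕ} (μ : Measure (Fin d → ℝ)) (A : Matrix (Fin d) (Fin d) ℝ)
    (B : Matrix (Fin m) (Fin d) ℝ) (A' : Matrix (Fin d) (Fin d) ℝ)
    (B' : Matrix (Fin m) (Fin d) ℝ) : ℝ :=
  1 / 2 * ∫ x, sqNorm (residualUnit A' B' x - residualUnit A B x) ∂μ

/-! ### Linear regression (least squares) -/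

/-- The empirical risk of the scalar linear model `v = k * u` on the samples with indices in `s`. -/
def scalarRisk (s : Finset ℕ) (u v : ℕ → ℝ) (k : ℝ) : ℝ :=
  1 / (2 * (s.card : ℝ)) * ∑ i ∈ s, (k * u i - v i) ^ 2

/-- `k` is a least squares solution of the scalar model `v = k * u`. -/
def IsScalarLR (s : Finset ℕ) (u v : ℕ → ℝ) (k : ℝ) : Prop :=
  ∀ k' : ℝ, scalarRisk s u v k ≤ scalarRisk s u v k'

/-- The empirical risk of the linear model `v = L u` on the samples with indices in `s`. -/
def vectorRisk {p q : ℕ} (s : Finset ℕ) (u : ℕ → Fin p → ℝ) (v : ℕ → Fin q → ℝ)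
    (L : Matrix (Fin q) (Fin p) ℝ) : ℝ :=
  1 / (2 * (s.card : ℝ)) * ∑ i ∈ s, sqNorm (L *ᵥ u i - v i)

/-- `L` is a least squares solution of the model `v = L u`. -/
def IsVectorLR {p q : ℕ} (s : Finset ℕ) (u : ℕ → Fin p → ℝ) (v : ℕ → Fin q → ℝ)
    (L : Matrix (Fin q) (Fin p) ℝ) : Prop :=
  ∀ L' : Matrix (Fin q) (Fin p) ℝ, vectorRisk s u v L ≤ vectorRisk s u v L'

/-! ### Layer 2: quadratic program, linear program, scale factors -/

/-- The objective of the layer 2 quadratic program on the first `n` samples. -/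
def layer2Objective {d m : ℕ} (n : ℕ) (x : ℕ → Fin d → ℝ) (y : ℕ → Fin m → ℝ)
    (C : Matrix (Fin d) (Fin m) ℝ) (Ξ : ℕ → Fin d → ℝ) : ℝ :=
  1 / (2 * (n : ℝ)) * ∑ i ∈ Finset.range n, sqNorm (Ξ i + x i - C *ᵥ y i)

/-- `(C, Ξ)` solves the layer 2 quadratic program (only `Ξ i` with `i < n` matter). -/
def IsLayer2QP {d m : ℕ} (n : ℕ) (x : ℕ → Fin d → ℝ) (y : ℕ → Fin m → ℝ)
    (C : Matrix (Fin d) (Fin m) ℝ) (Ξ : ℕ → Fin d → ℝ) : Prop :=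
  (∀ i < n, 0 ≤ Ξ i) ∧
    ∀ (C' : Matrix (Fin d) (Fin m) ℝ) (Ξ' : ℕ → Fin d → ℝ), (∀ i < n, 0 ≤ Ξ' i) →
      layer2Objective n x y C Ξ ≤ layer2Objective n x y C' Ξ'

/-- `C` solves the layer 2 linear program (its objective is constant, so that the solutions are
the feasible points), and `Ξ` is read off from `C`. -/
def IsLayer2LP {d m : ℕ} (n : ℕ) (x : ℕ → Fin d → ℝ) (y : ℕ → Fin m → ℝ)
    (C : Matrix (Fin d) (Fin m) ℝ) (Ξ : ℕ → Fin d → ℝ) : Prop :=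
  (∀ i < n, 0 ≤ C *ᵥ y i - x i) ∧ ∀ i < n, Ξ i = C *ᵥ y i - x i

/-- `(C, Ξ)` is a possible outcome of the QP/LP step of layer 2 on the first `n` samples. The
function estimate is evaluated at the remaining inputs by `Ξ i = C (y i) - x i`. -/
def IsLayer2Solution {d m : ℕ} (n : ℕ) (x : ℕ → Fin d → ℝ) (y : ℕ → Fin m → ℝ)
    (C : Matrix (Fin d) (Fin m) ℝ) (Ξ : ℕ → Fin d → ℝ) : Prop :=
  (IsLayer2QP n x y C Ξ ∨ IsLayer2LP n x y C Ξ) ∧ ∀ i, n ≤ i → Ξ i = C *ᵥ y i - x i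

/-- `k` is a possible layer 2 scale factor of the component `j`: a least squares solution of the
model `(C y)_j = k x_j` on those of the first `n` samples that have `x_j < 0`, replaced by `1` if
the optimal value of the regression exceeds the tolerance `ε`. -/
def IsLayer2ScaleFactor {d m : ℕ} (ε : ℝ) (n : ℕ) (x : ℕ → Fin d → ℝ) (y : ℕ → Fin m → ℝ)
    (C : Matrix (Fin d) (Fin m) ℝ) (j : Fin d) (k : ℝ) : Prop :=
  let s := (Finset.range n).filter (fun i => x i j < 0)
  let u := fun i => x i j
  let v := fun i => (C *ᵥ y i) j
  ∃ k₀ : ℝ, IsScalarLR s u v k₀ ∧ k = if ε < scalarRisk s u v k₀ then 1 else k₀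

/-! ### Layer 1: quadratic program, linear program, scale factors -/

/-- The objective of the layer 1 quadratic program on the first `n` samples. -/
def layer1Objective {d : ℕ} (n : ℕ) (x h : ℕ → Fin d → ℝ)
    (A : Matrix (Fin d) (Fin d) ℝ) (Φ : ℕ → Fin d → ℝ) : ℝ :=
  1 / (2 * (n : ℝ)) * ∑ i ∈ Finset.range n, sqNorm (Φ i + A *ᵥ x i - h i)

/-- `(A, Φ)` solves the layer 1 quadratic program (only `Φ i` with `i < n` matter). -/
def IsLayer1QP {d : ℕ} (n : ℕ) (x h : ℕ → Fin d → ℝ)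
    (A : Matrix (Fin d) (Fin d) ℝ) (Φ : ℕ → Fin d → ℝ) : Prop :=
  (∀ i < n, 0 ≤ Φ i) ∧
    ∀ (A' : Matrix (Fin d) (Fin d) ℝ) (Φ' : ℕ → Fin d → ℝ), (∀ i < n, 0 ≤ Φ' i) →
      layer1Objective n x h A Φ ≤ layer1Objective n x h A' Φ'

/-- `A` solves the layer 1 linear program (its objective is constant). -/
def IsLayer1LP {d : ℕ} (n : ℕ) (x h : ℕ → Fin d → ℝ) (A : Matrix (Fin d) (Fin d) ℝ) : Prop :=
  ∀ i < n, 0 ≤ h i - A *ᵥ x i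

/-- `A` is a possible outcome of the QP/LP step of layer 1 on the first `n` samples. -/
def IsLayer1Solution {d : ℕ} (n : ℕ) (x h : ℕ → Fin d → ℝ)
    (A : Matrix (Fin d) (Fin d) ℝ) : Prop :=
  (∃ Φ : ℕ → Fin d → ℝ, IsLayer1QP n x h A Φ) ∨ IsLayer1LP n x h A

/-- `k` is a possible layer 1 scale factor of the component `j`: a least squares solution of the
model `(A x)_j = k h_j` on those of the first `n` samples that have `h_j > 0`. -/
def IsLayer1ScaleFactor {d : ℕ} (n : ℕ) (x h : ℕ → Fin d → ℝ)
    (A : Matrix (Fin d) (Fin d) ℝ) (j : Fin d) (k : ℝ) : Prop :=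
  IsScalarLR ((Finset.range n).filter (fun i => 0 < h i j)) (fun i => h i j)
    (fun i => (A *ᵥ x i) j) k

/-! ### The full algorithm -/

/-- The number of samples used in each step: the first `n` of the samples are used in a step to
which the size `n` is assigned. -/
structure SampleSizes where
  /-- the size for the layer 2 QP/LP -/
  layer2 : ℕ
  /-- the size for the layer 2 scale factors -/
  scale2 : ℕ
  /-- the size for the linear regression of the layer 2 weights -/
  regress : ℕ
  /-- the size for the layer 1 QP/LP -/
  layer1 : ℕ
  /-- the size for the layer 1 scale factors -/
  scale1 : ℕ

/-- All the sample sizes tend to infinity. -/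
structure SampleSizes.TendToInfinity (N : ℕ → SampleSizes) : Prop where
  layer2 : Tendsto (fun t => (N t).layer2) atTop atTop
  scale2 : Tendsto (fun t => (N t).scale2) atTop atTop
  regress : Tendsto (fun t => (N t).regress) atTop atTop
  layer1 : Tendsto (fun t => (N t).layer1) atTop atTop
  scale1 : Tendsto (fun t => (N t).scale1) atTop atTop

/-- The quantities computed in one execution of the full algorithm. -/
structure RunData (d m : ℕ) where
  /-- the solution of the layer 2 QP/LP -/
  C : Matrix (Fin d) (Fin m) ℝ
  /-- the function values found by the layer 2 QP/LP -/
  Ξ : ℕ → Fin d → ℝ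
  /-- the layer 2 scale factors -/
  k₂ : Fin d → ℝ
  /-- the estimate of the layer 2 weights -/
  B : Matrix (Fin m) (Fin d) ℝ
  /-- the estimates of the hidden outputs, the targets of layer 1 -/
  h : ℕ → Fin d → ℝ
  /-- the solution of the layer 1 QP/LP -/
  A₀ : Matrix (Fin d) (Fin d) ℝ
  /-- the layer 1 scale factors -/
  k₁ : Fin d → ℝ
  /-- the estimate of the layer 1 weights -/
  A : Matrix (Fin d) (Fin d) ℝ

/-- The layer 1 part of an execution, run on the inputs `x` and the estimated hidden outputs. -/
structure IsLayer1Run {d m : ℕ} (N : SampleSizes) (x : ℕ → Fin d → ℝ) (R : RunData d m) :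
    Prop where
  solve : IsLayer1Solution N.layer1 x R.h R.A₀
  scale : ∀ j, IsLayer1ScaleFactor N.scale1 x R.h R.A₀ j (R.k₁ j)
  rescale : ∀ j, R.A j = (R.k₁ j)⁻¹ • R.A₀ j

/-- The general layer 2 part of an execution, with tolerance `ε`: QP/LP, scale factors, linear
regression of `y` on `diag(k)⁻¹ C y`, and correction of the function estimate. -/
structure IsLayer2Run {d m : ℕ} (ε : ℝ) (N : SampleSizes) (x : ℕ → Fin d → ℝ)
    (y : ℕ → Fin m → ℝ) (R : RunData d m) : Prop where
  solve : IsLayer2Solution N.layer2 x y R.C R.Ξ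
  scale : ∀ j, IsLayer2ScaleFactor ε N.scale2 x y R.C j (R.k₂ j)
  regress : IsVectorLR (Finset.range N.regress)
    (fun i => diagonal (fun j => (R.k₂ j)⁻¹) *ᵥ (R.C *ᵥ y i)) y R.B
  correct : ∀ i, R.h i = diagonal (fun j => (R.k₂ j)⁻¹) *ᵥ (R.Ξ i + x i) - x i

/-- The simple layer 2 part of an execution, for square layer 2 weights: QP/LP and inversion
(no scale factors and no regression). -/
structure IsSimpleLayer2Run {d : ℕ} (N : SampleSizes) (x y : ℕ → Fin d → ℝ) (R : RunData d d) :
    Prop where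
  solve : IsLayer2Solution N.layer2 x y R.C R.Ξ
  invert : R.B = R.C⁻¹
  keep : ∀ i, R.h i = R.Ξ i

end

end ResidualUnit

open ResidualUnit

/-!
The samples enter the proof only through two almost sure properties, given by the strong law of
large numbers: every nonempty open set is visited with a positive asymptotic frequency, and the
empirical second moments are bounded (`IsRichSample`, `exists_ae_isRichSample`). The frequency
bounds depend on `μ` alone. Along one such sequence everything is deterministic and can be done row
by row.

Layer 2. Write `f x = (A x)⁺ + x` (`hidden`) and `M = C B`. The quadratic program has the optimal
value zero, so that in every case the rows of `M` satisfy `M j · f x ≥ x j` on the samples. In the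
limit this must hold for all `x`; testing it with `x = -eₖ` and with `A x = ±eₖ` shows that row `j`
is a multiple of `eⱼ` (`feasible_row`). If `j` is not a scale component, then the vectors `f x` with
`(A x) j ≤ 0`, for which `eⱼ` satisfies the constraint with equality, are not contained in a
half-space; by compactness finitely many of them suffice, and row `j` is exactly `eⱼ` after finitely
many samples (`eventually_row_eq_single`). In this case the `j`-th coordinate of `f x` is not linear
in `x j` on `x j < 0`, which keeps the regression risk above some `ε₀`, and the scale factor is
exactly `1` (`exists_eventually_le_scalarRisk`). For a scale component the regression recovers the
unknown multiple in the limit (`tendsto_rescaled_row`). Hence `D = diag(k)⁻¹ M` tends to the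
identity, and the regression of `y` on `D f` gives `B D⁻¹`, which tends to `B`.

Layer 1. The targets are `(A x)⁺ + (D - 1) f x`, and a feasible row `a` satisfies
`a · x ≤ (A j · x)⁺` in the limit, which forces `a = ℓ A j` with `0 ≤ ℓ ≤ 1`; the slope of the last
regression is asymptotically `ℓ` (`tendsto_slope_sub_rowCoeff`). For a scale component the targets
are only approximate, and the lower bound on the slopes permits the division
(`tendsto_row_of_approx`). For the other components the targets are exact, and the constraints with
`A j · x < 0` cut out cones that shrink to the ray of `A j`. The direction of `a` therefore
converges even if `ℓ` tends to zero, and it is enough that the slopes do not vanish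
(`tendsto_row_of_exact`).

Finally, the output loss is continuous at the true weights (`tendsto_outputLoss`).
-/

namespace ResidualUnit

/-! ### Rich samples and the law of large numbers -/

/-- A sequence of inputs that visits every nonempty open set `U` with asymptotic frequency at
least `c U`, and whose empirical second moments stay bounded. -/
structure IsRichSample {d : ℕ} (c : Set (Fin d → ℝ) → ℝ) (x : ℕ → Fin d → ℝ) : Prop where
  frequency : ∀ U, IsOpen U → U.Nonempty →
    ∀ᶠ n : ℕ in atTop, c U * n ≤ ∑ i ∈ Finset.range n, U.indicator 1 (x i)
  energy : ∃ K : ℝ, 0 < K ∧ ∀ᶠ n : ℕ in atTop, ∑ i ∈ Finset.range n, ‖x i‖ ^ 2 ≤ K * n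

lemma tendsto_empirical_mean {d : ℕ} {μ : Measure (Fin d → ℝ)} {Ω : Type*} [MeasurableSpace Ω]
    {P : Measure Ω} [IsProbabilityMeasure P] {X : ℕ → Ω → Fin d → ℝ}
    (hX : ∀ i, HasLaw (X i) μ P) (hind : iIndepFun X P) {g : (Fin d → ℝ) → ℝ}
    (hg : Measurable g) (hgi : Integrable g μ) :
    ∀ᵐ ω ∂P, Tendsto (fun n : ℕ => (∑ i ∈ Finset.range n, g (X i ω)) / n) atTop
      (nhds (∫ x, g x ∂μ)) := by
  have h0 : ∫ ω, g (X 0 ω) ∂P = ∫ x, g x ∂μ :=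
    (hX 0).integral_comp hgi.aestronglyMeasurable
  rw [← h0]
  refine strong_law_ae_real (fun i ω => g (X i ω)) ?_ ?_ ?_
  · have := hgi
    rw [← (hX 0).map_eq] at this
    exact this.comp_aemeasurable (hX 0).aemeasurable
  · intro i j hij
    exact (hind.indepFun hij).comp hg hg
  · intro i
    have : IdentDistrib (X i) (X 0) P P :=
      ⟨(hX i).aemeasurable, (hX 0).aemeasurable, by rw [(hX i).map_eq, (hX 0).map_eq]⟩
    exact this.comp hg

lemma norm_sq_le_sqNorm {p : ℕ} (v : Fin p → ℝ) : ‖v‖ ^ 2 ≤ sqNorm v := by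
  have h0 : 0 ≤ sqNorm v := Finset.sum_nonneg fun j _ => sq_nonneg _
  refine (Real.le_sqrt (norm_nonneg _) h0).1 ?_
  refine (pi_norm_le_iff_of_nonneg (Real.sqrt_nonneg _)).2 fun j => ?_
  refine Real.le_sqrt_of_sq_le ?_
  rw [Real.norm_eq_abs, sq_abs]
  exact Finset.single_le_sum (f := fun j => v j ^ 2) (fun j _ => sq_nonneg _) (Finset.mem_univ j)

/-- The strong law of large numbers, applied to the members of a countable basis and to the squared
norm: the frequency bounds depend on the law of the inputs alone. -/
lemma exists_ae_isRichSample {d : ℕ} (μ : Measure (Fin d → ℝ)) [IsProbabilityMeasure μ]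
    (hsupp : ∀ U : Set (Fin d → ℝ), IsOpen U → U.Nonempty → 0 < μ U)
    (hmom : Integrable (fun x : Fin d → ℝ => sqNorm x) μ) :
    ∃ c : Set (Fin d → ℝ) → ℝ, (∀ U, IsOpen U → U.Nonempty → 0 < c U) ∧
      ∀ (Ω : Type*) [MeasurableSpace Ω] (P : Measure Ω) [IsProbabilityMeasure P]
        (X : ℕ → Ω → Fin d → ℝ), (∀ i, HasLaw (X i) μ P) → iIndepFun X P →
        ∀ᵐ ω ∂P, IsRichSample c (fun i => X i ω) := by
  have hb := TopologicalSpace.isBasis_countableBasis (Fin d → ℝ)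
  have hV : ∀ U : Set (Fin d → ℝ), ∃ V : Set (Fin d → ℝ), IsOpen U → U.Nonempty →
      V ∈ TopologicalSpace.countableBasis (Fin d → ℝ) ∧ V.Nonempty ∧ V ⊆ U := by
    intro U
    by_cases hU : IsOpen U ∧ U.Nonempty
    · obtain ⟨hU, x, hx⟩ := hU
      obtain ⟨V, hV, hxV, hVU⟩ := hb.exists_subset_of_mem_open hx hU
      exact ⟨V, fun _ _ => ⟨hV, ⟨x, hxV⟩, hVU⟩⟩
    · exact ⟨∅, fun h1 h2 => (hU ⟨h1, h2⟩).elim⟩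
  choose V hV using hV
  have hpos : ∀ U, IsOpen U → U.Nonempty → 0 < μ.real (V U) := fun U hU hne =>
    ENNReal.toReal_pos (hsupp _ (hb.isOpen (hV U hU hne).1) (hV U hU hne).2.1).ne'
      (measure_ne_top _ _)
  refine ⟨fun U => μ.real (V U) / 2, fun U hU hne => half_pos (hpos U hU hne), ?_⟩
  intro Ω _ P _ X hX hind
  have h1 : ∀ᵐ ω ∂P, ∀ W ∈ TopologicalSpace.countableBasis (Fin d → ℝ),
      Tendsto (fun n : ℕ => (∑ i ∈ Finset.range n, W.indicator (1 : (Fin d → ℝ) → ℝ) (X i ω)) / n)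
        atTop (nhds (μ.real W)) := by
    refine (ae_ball_iff (TopologicalSpace.countable_countableBasis _)).2 fun W hW => ?_
    have hWm := (hb.isOpen hW).measurableSet
    have := tendsto_empirical_mean hX hind (measurable_one.indicator hWm)
      ((integrable_const (1 : ℝ)).indicator hWm)
    simpa only [integral_indicator_one hWm] using this
  have h2 := tendsto_empirical_mean hX hind (g := fun x => ‖x‖ ^ 2) (by fun_prop)
    (hmom.mono' (by fun_prop) (ae_of_all _ fun x => by
      simpa using norm_sq_le_sqNorm x))
  filter_upwards [h1, h2] with ω h1 h2
  refine ⟨fun U hU hne => ?_, ∫ x, ‖x‖ ^ 2 ∂μ + 1, ?_, ?_⟩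
  · obtain ⟨hVb, -, hVU⟩ := hV U hU hne
    filter_upwards [(h1 _ hVb).eventually_const_le (half_lt_self (hpos U hU hne)),
      eventually_gt_atTop 0] with n hn hn0
    rw [le_div_iff₀ (by exact_mod_cast hn0)] at hn
    exact hn.trans (Finset.sum_le_sum fun i _ =>
      Set.indicator_le_indicator_of_subset hVU (fun _ => zero_le_one) _)
  · have : 0 ≤ ∫ x, ‖x‖ ^ 2 ∂μ := integral_nonneg fun _ => by positivity
    linarith
  · filter_upwards [h2.eventually_le_const (lt_add_one _), eventually_gt_atTop 0] with n hn hn0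
    rwa [div_le_iff₀ (by exact_mod_cast hn0)] at hn

/-! ### Compactness and density -/

/-- A sequence in a compact set is eventually in every open set that contains its cluster points. -/
lemma eventually_mem_of_mapClusterPt {E : Type*} [TopologicalSpace E] {K U : Set E}
    (hK : IsCompact K) (hU : IsOpen U) {a : ℕ → E} (ha : ∀ᶠ t in atTop, a t ∈ K)
    (h : ∀ b, MapClusterPt b atTop a → b ∈ U) : ∀ᶠ t in atTop, a t ∈ U :=
  hK.adherence_nhdset (f := map a atTop) (le_principal_iff.2 ha) hU fun b _ hb => h b hb

/-- If `q = 0` is the only vector that has a nonnegative product with all `w i`, then finitely many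
of the `w i` already detect every `q ≠ 0`, with a margin proportional to `‖q‖`. -/
lemma exists_finite_test {d : ℕ} (w : ℕ → Fin d → ℝ)
    (hw : ∀ q : Fin d → ℝ, (∀ i, 0 ≤ q ⬝ᵥ w i) → q = 0) :
    ∃ (n : ℕ) (r : ℝ), 0 < r ∧ ∀ q : Fin d → ℝ, q ≠ 0 → ∃ i < n, q ⬝ᵥ w i < -r * ‖q‖ := by
  obtain ⟨n, hn⟩ := (isCompact_sphere (0 : Fin d → ℝ) 1).elim_directed_cover
    (fun n : ℕ => ⋃ i ∈ Finset.range n, {q : Fin d → ℝ | q ⬝ᵥ w i < -(1 / ((n : ℝ) + 1))})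
    (fun n => isOpen_biUnion fun i _ => isOpen_lt (by fun_prop) continuous_const) (by
      intro q hq
      have hq0 : q ≠ 0 := by rintro rfl; simp at hq
      obtain ⟨i, hi⟩ : ∃ i, q ⬝ᵥ w i < 0 := by
        by_contra! hcon
        exact hq0 (hw q hcon)
      obtain ⟨m, hm⟩ := exists_nat_one_div_lt (neg_pos.2 hi)
      refine Set.mem_iUnion.2 ⟨max m (i + 1), Set.mem_biUnion (x := i) (by simp) ?_⟩
      have : (1 : ℝ) / ((max m (i + 1) : ℕ) + 1) ≤ 1 / (m + 1) :=
        Nat.one_div_le_one_div (le_max_left _ _)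
      show q ⬝ᵥ w i < _
      linarith)
    (by
      refine (Monotone.directed_le fun a b hab => ?_)
      intro q hq
      simp only [Set.mem_iUnion, Set.mem_ofPred_eq, Finset.mem_range] at hq ⊢
      obtain ⟨i, hi, h⟩ := hq
      have : (1 : ℝ) / (b + 1) ≤ 1 / (a + 1) := Nat.one_div_le_one_div hab
      exact ⟨i, hi.trans_le hab, by linarith⟩)
  refine ⟨n, 1 / ((n : ℝ) + 1), by positivity, fun q hq => ?_⟩
  have hq0 : 0 < ‖q‖ := norm_pos_iff.2 hq
  have hmem := hn (show ‖q‖⁻¹ • q ∈ _ by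
    rw [mem_sphere_zero_iff_norm, norm_smul, norm_inv, norm_norm, inv_mul_cancel₀ hq0.ne'])
  simp only [Set.mem_iUnion, Set.mem_ofPred_eq, Finset.mem_range] at hmem
  obtain ⟨i, hi, h⟩ := hmem
  refine ⟨i, hi, ?_⟩
  rw [smul_dotProduct, smul_eq_mul, inv_mul_lt_iff₀ hq0] at h
  linarith

lemma abs_dotProduct_le {d : ℕ} (a x : Fin d → ℝ) : |a ⬝ᵥ x| ≤ d * ‖a‖ * ‖x‖ := by
  calc |a ⬝ᵥ x| ≤ ∑ k, |a k * x k| := Finset.abs_sum_le_sum_abs _ _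
    _ ≤ ∑ _k : Fin d, ‖a‖ * ‖x‖ := by
        refine Finset.sum_le_sum fun k _ => ?_
        rw [abs_mul]
        exact mul_le_mul (norm_le_pi_norm a k) (norm_le_pi_norm x k) (abs_nonneg _)
          (norm_nonneg _)
    _ = d * ‖a‖ * ‖x‖ := by simp [mul_assoc]

namespace IsRichSample

variable {d : ℕ} {c : Set (Fin d → ℝ) → ℝ} {x : ℕ → Fin d → ℝ}

lemma exists_mem (hx : IsRichSample c x) (hc : ∀ U, IsOpen U → U.Nonempty → 0 < c U)
    {U : Set (Fin d → ℝ)} (hU : IsOpen U) (hne : U.Nonempty) : ∃ i, x i ∈ U := by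
  by_contra! hcon
  obtain ⟨n, hn, hn0⟩ := ((hx.frequency U hU hne).and (eventually_gt_atTop 0)).exists
  have h0 : ∑ i ∈ Finset.range n, U.indicator (1 : (Fin d → ℝ) → ℝ) (x i) = 0 :=
    Finset.sum_eq_zero fun i _ => Set.indicator_of_notMem (hcon i) _
  have : 0 < c U * n := mul_pos (hc U hU hne) (by exact_mod_cast hn0)
  linarith

/-- A continuous inequality that holds at the sample points in an open set holds on its closure. -/
lemma nonneg_of_forall (hx : IsRichSample c x) (hc : ∀ U, IsOpen U → U.Nonempty → 0 < c U)
    {O : Set (Fin d → ℝ)} (hO : IsOpen O) {g : (Fin d → ℝ) → ℝ} (hg : Continuous g)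
    (h : ∀ i, x i ∈ O → 0 ≤ g (x i)) {z : Fin d → ℝ} (hz : z ∈ closure O) : 0 ≤ g z := by
  have hsub : O ⊆ {z | 0 ≤ g z} := by
    intro z hzO
    by_contra hcon
    have hopen : IsOpen {z | g z < 0} := isOpen_lt hg continuous_const
    have hz0 : g z < 0 := not_le.1 hcon
    obtain ⟨i, hi1, hi2⟩ := hx.exists_mem hc (hO.inter hopen) ⟨z, hzO, hz0⟩
    exact absurd (h i hi1) (not_le.2 hi2)
  exact closure_minimal hsub (isClosed_le continuous_const hg) hz

/-- A nonnegative statistic that is at least `η` on `U` has empirical mean at least `η * c U`. -/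
lemma eventually_le_sum (hx : IsRichSample c x) {U : Set (Fin d → ℝ)} (hU : IsOpen U)
    (hne : U.Nonempty) {η : ℝ} (hη : 0 ≤ η) :
    ∀ᶠ n : ℕ in atTop, ∀ g : ℕ → ℝ, (∀ i, 0 ≤ g i) → (∀ i, x i ∈ U → η ≤ g i) →
      η * c U * n ≤ ∑ i ∈ Finset.range n, g i := by
  filter_upwards [hx.frequency U hU hne] with n hn g hg0 hg
  calc η * c U * n = η * (c U * n) := by ring
    _ ≤ η * ∑ i ∈ Finset.range n, U.indicator (1 : (Fin d → ℝ) → ℝ) (x i) :=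
        mul_le_mul_of_nonneg_left hn hη
    _ = ∑ i ∈ Finset.range n, η * U.indicator (1 : (Fin d → ℝ) → ℝ) (x i) := Finset.mul_sum ..
    _ ≤ _ := by
        refine Finset.sum_le_sum fun i _ => ?_
        by_cases hi : x i ∈ U
        · simpa [hi] using hg i hi
        · simpa [hi] using hg0 i

end IsRichSample

/-! ### The inequalities that characterize the hidden layer -/

/-- The output `(A x)⁺ + x` of the hidden layer on the input `x`. -/
def hidden {d : ℕ} (A : Matrix (Fin d) (Fin d) ℝ) (x : Fin d → ℝ) : Fin d → ℝ :=
  relu (A *ᵥ x) + x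

section hidden

variable {d : ℕ} {A : Matrix (Fin d) (Fin d) ℝ}

lemma hidden_apply (x : Fin d → ℝ) (j : Fin d) : hidden A x j = max 0 (A j ⬝ᵥ x) + x j := rfl

lemma residualUnit_eq {m : ℕ} (B : Matrix (Fin m) (Fin d) ℝ) (x : Fin d → ℝ) :
    residualUnit A B x = B *ᵥ hidden A x := rfl

@[fun_prop]
lemma continuous_hidden : Continuous (hidden A) := by
  refine continuous_pi fun j => ?_
  simp only [hidden_apply]
  fun_prop

lemma exists_norm_hidden_le (A : Matrix (Fin d) (Fin d) ℝ) :
    ∃ F : ℝ, 0 < F ∧ ∀ x, ‖hidden A x‖ ≤ F * ‖x‖ := by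
  refine ⟨d * (∑ j, ‖A j‖) + 1, by positivity, fun x => ?_⟩
  refine (pi_norm_le_iff_of_nonneg (by positivity)).2 fun j => ?_
  have h1 := abs_dotProduct_le (A j) x
  have h2 : ‖A j‖ ≤ ∑ j, ‖A j‖ :=
    Finset.single_le_sum (f := fun j => ‖A j‖) (fun _ _ => norm_nonneg _) (Finset.mem_univ j)
  have h3 : |max 0 (A j ⬝ᵥ x)| ≤ |A j ⬝ᵥ x| := by
    rw [abs_of_nonneg (le_max_left _ _)]
    exact max_le (abs_nonneg _) (le_abs_self _)
  have h4 := norm_le_pi_norm x j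
  rw [Real.norm_eq_abs] at h4
  rw [hidden_apply, Real.norm_eq_abs]
  calc |max 0 (A j ⬝ᵥ x) + x j| ≤ |max 0 (A j ⬝ᵥ x)| + |x j| := abs_add_le _ _
    _ ≤ d * (∑ j, ‖A j‖) * ‖x‖ + ‖x‖ := by
        refine add_le_add (h3.trans (h1.trans ?_)) h4
        gcongr
    _ = _ := by ring

lemma hidden_of_nonpos (hA : ∀ i j, 0 ≤ A i j) {x : Fin d → ℝ} (hx : x ≤ 0) : hidden A x = x := by
  ext j
  rw [hidden_apply, max_eq_left, zero_add]
  exact Finset.sum_nonpos fun k _ => mul_nonpos_of_nonneg_of_nonpos (hA j k) (hx k)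

lemma row_ne_zero (hA : IsUnit A.det) (j : Fin d) : A j ≠ 0 := fun h =>
  hA.ne_zero (det_eq_zero_of_row_eq_zero j fun k => congrFun h k)

lemma row_dotProduct_inv_mulVec (hA : IsUnit A.det) (j : Fin d) (z : Fin d → ℝ) :
    A j ⬝ᵥ (A⁻¹ *ᵥ z) = z j := by
  have : A *ᵥ (A⁻¹ *ᵥ z) = z := by rw [mulVec_mulVec, mul_nonsing_inv A hA, one_mulVec]
  exact congrFun this j

lemma hidden_inv_mulVec (hA : IsUnit A.det) (z : Fin d → ℝ) :
    hidden A (A⁻¹ *ᵥ z) = relu z + A⁻¹ *ᵥ z := by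
  rw [hidden, mulVec_mulVec, mul_nonsing_inv A hA, one_mulVec]

/-- A half-space is the closure of its interior. -/
lemma mem_closure_halfSpace (hA : IsUnit A.det) {j : Fin d} {x : Fin d → ℝ}
    (hx : A j ⬝ᵥ x ≤ 0) : x ∈ closure {x : Fin d → ℝ | A j ⬝ᵥ x < 0} := by
  have hlim : Tendsto (fun n : ℕ => x - (1 / ((n : ℝ) + 1)) • (A⁻¹ *ᵥ Pi.single j 1)) atTop
      (nhds (x - (0 : ℝ) • (A⁻¹ *ᵥ Pi.single j 1))) :=
    tendsto_const_nhds.sub (tendsto_one_div_add_atTop_nhds_zero_nat.smul_const _)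
  rw [zero_smul, sub_zero] at hlim
  refine mem_closure_of_tendsto hlim (Eventually.of_forall fun n => ?_)
  have : (0 : ℝ) < 1 / ((n : ℝ) + 1) := by positivity
  simp only [Set.mem_ofPred_eq, dotProduct_sub, dotProduct_smul, row_dotProduct_inv_mulVec hA,
    Pi.single_eq_same, smul_eq_mul]
  linarith

/-- The coefficient with which `A j` enters the expansion of a vector in the rows of `A`, for
invertible `A`. -/
noncomputable def rowCoeff (A : Matrix (Fin d) (Fin d) ℝ) (j : Fin d) (a : Fin d → ℝ) : ℝ :=
  a ⬝ᵥ (A⁻¹ *ᵥ Pi.single j 1)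

lemma eq_rowCoeff_smul (hA : IsUnit A.det) {j : Fin d} {a : Fin d → ℝ}
    (h : ∀ k, k ≠ j → rowCoeff A k a = 0) : a = rowCoeff A j a • A j := by
  have h1 : a ᵥ* A⁻¹ = Pi.single j (rowCoeff A j a) := by
    ext k
    have : (a ᵥ* A⁻¹) k = rowCoeff A k a := by
      rw [rowCoeff, dotProduct_mulVec, dotProduct_single, mul_one]
    rw [this]
    by_cases hk : k = j
    · subst hk; simp
    · rw [h k hk, Pi.single_eq_of_ne hk]
  calc a = (a ᵥ* A⁻¹) ᵥ* A := by rw [vecMul_vecMul, nonsing_inv_mul A hA, vecMul_one]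
    _ = _ := by rw [h1, single_vecMul]; rfl

lemma continuous_rowCoeff (j : Fin d) : Continuous (rowCoeff A j) := by
  unfold rowCoeff; fun_prop

/-- Farkas' lemma for one half-space, in the coordinates `A x`. -/
lemma eq_rowCoeff_smul_of_halfSpace (hA : IsUnit A.det) {j : Fin d} {a : Fin d → ℝ}
    (h : ∀ x, A j ⬝ᵥ x ≤ 0 → a ⬝ᵥ x ≤ 0) : 0 ≤ rowCoeff A j a ∧ a = rowCoeff A j a • A j := by
  have key : ∀ k, k ≠ j → rowCoeff A k a = 0 := by
    intro k hk
    have h1 := h (A⁻¹ *ᵥ Pi.single k 1)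
      (by rw [row_dotProduct_inv_mulVec hA, Pi.single_eq_of_ne hk.symm])
    have h2 := h (-(A⁻¹ *ᵥ Pi.single k 1))
      (by rw [dotProduct_neg, row_dotProduct_inv_mulVec hA, Pi.single_eq_of_ne hk.symm, neg_zero])
    rw [dotProduct_neg] at h2
    exact le_antisymm h1 (by unfold rowCoeff; linarith)
  refine ⟨?_, eq_rowCoeff_smul hA key⟩
  have h2 := h (-(A⁻¹ *ᵥ Pi.single j 1))
    (by rw [dotProduct_neg, row_dotProduct_inv_mulVec hA, Pi.single_eq_same]; norm_num)
  rw [dotProduct_neg] at h2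
  unfold rowCoeff; linarith

lemma rowCoeff_le_one (hA : IsUnit A.det) {j : Fin d} {a : Fin d → ℝ}
    (h : ∀ x, a ⬝ᵥ x ≤ max 0 (A j ⬝ᵥ x)) : rowCoeff A j a ≤ 1 := by
  have h1 := h (A⁻¹ *ᵥ Pi.single j 1)
  rwa [row_dotProduct_inv_mulVec hA, Pi.single_eq_same, max_eq_right zero_le_one] at h1

lemma nonpos_of_dotProduct_hidden_nonneg (hA0 : ∀ i j, 0 ≤ A i j) {j : Fin d} {q : Fin d → ℝ}
    (h : ∀ x, A j ⬝ᵥ x ≤ 0 → 0 ≤ q ⬝ᵥ hidden A x) (k : Fin d) : q k ≤ 0 := by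
  have hneg : -(Pi.single k 1 : Fin d → ℝ) ≤ 0 := neg_nonpos.2 (Pi.single_nonneg.2 zero_le_one)
  have h1 := h (-Pi.single k 1) (by
    rw [dotProduct_neg, dotProduct_single, mul_one]
    exact neg_nonpos.2 (hA0 j k))
  rw [hidden_of_nonpos hA0 hneg, dotProduct_neg, dotProduct_single, mul_one] at h1
  linarith

lemma relu_single {k : Fin d} : relu (Pi.single k 1 : Fin d → ℝ) = Pi.single k 1 := by
  ext i
  exact max_eq_right ((Pi.single_nonneg.2 zero_le_one : (0 : Fin d → ℝ) ≤ Pi.single k 1) i)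

lemma relu_neg_single {k : Fin d} : relu (-Pi.single k 1 : Fin d → ℝ) = 0 := by
  ext i
  refine max_eq_left ?_
  have := ((Pi.single_nonneg.2 zero_le_one : (0 : Fin d → ℝ) ≤ Pi.single k 1) i)
  simpa using this

/-- Testing with `A x = ±eₖ` confines the `k`-th coefficient of a vector. -/
lemma rowCoeff_bounds {k : Fin d} {p q : Fin d → ℝ}
    (h1 : 0 ≤ p ⬝ᵥ relu (Pi.single k 1 : Fin d → ℝ) + q ⬝ᵥ (A⁻¹ *ᵥ Pi.single k 1))
    (h2 : 0 ≤ p ⬝ᵥ relu (-Pi.single k 1 : Fin d → ℝ) + q ⬝ᵥ (A⁻¹ *ᵥ (-Pi.single k 1))) :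
    rowCoeff A k q ≤ 0 ∧ -rowCoeff A k q ≤ p k := by
  rw [relu_single, dotProduct_single, mul_one] at h1
  rw [relu_neg_single, dotProduct_zero, mulVec_neg, dotProduct_neg] at h2
  unfold rowCoeff
  constructor <;> linarith

/-- If `j` is not a scale component, then the vectors `hidden A x` with `(A x) j ≤ 0` are not
contained in any half-space. -/
lemma eq_zero_of_dotProduct_hidden_nonneg (hA0 : ∀ i j, 0 ≤ A i j) (hA : IsUnit A.det) {j : Fin d}
    (hj : ¬ IsScaleTransformation A j) {q : Fin d → ℝ}
    (h : ∀ x, A j ⬝ᵥ x ≤ 0 → 0 ≤ q ⬝ᵥ hidden A x) : q = 0 := by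
  have hq := nonpos_of_dotProduct_hidden_nonneg hA0 h
  have key : ∀ k, k ≠ j → rowCoeff A k q = 0 ∧ q k = 0 := by
    intro k hk
    have h1 := h (A⁻¹ *ᵥ Pi.single k 1)
      (by rw [row_dotProduct_inv_mulVec hA, Pi.single_eq_of_ne hk.symm])
    have h2 := h (A⁻¹ *ᵥ (-Pi.single k 1))
      (by rw [row_dotProduct_inv_mulVec hA, Pi.neg_apply, Pi.single_eq_of_ne hk.symm, neg_zero])
    rw [hidden_inv_mulVec hA, dotProduct_add] at h1 h2
    obtain ⟨h3, h4⟩ := rowCoeff_bounds h1 h2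
    have := hq k
    constructor <;> linarith
  have hrow := eq_rowCoeff_smul hA fun k hk => (key k hk).1
  have hsingle : q = q j • Pi.single j 1 := by
    ext k
    by_cases hk : k = j
    · subst hk; simp
    · simp [(key k hk).2, hk]
  by_contra hne
  have hr : rowCoeff A j q ≠ 0 := fun h0 => hne (by rw [hrow, h0, zero_smul])
  have hAj : A j = ((rowCoeff A j q)⁻¹ * q j) • (Pi.single j 1 : Fin d → ℝ) := by
    rw [mul_smul, ← hsingle]
    conv_rhs => rw [hrow, ← mul_smul]
    rw [← hrow, inv_mul_cancel₀ hr, one_smul]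
  refine hj ?_
  have hjj : A j j = (rowCoeff A j q)⁻¹ * q j := by
    have := congrFun hAj j
    simpa using this
  unfold IsScaleTransformation
  rw [hjj, ← hAj]

/-- The values of `hidden A` are not contained in any half-space. -/
lemma eq_zero_of_forall_dotProduct_hidden_nonneg (hA0 : ∀ i j, 0 ≤ A i j) (hA : IsUnit A.det)
    {q : Fin d → ℝ} (h : ∀ x, 0 ≤ q ⬝ᵥ hidden A x) : q = 0 := by
  ext k
  refine le_antisymm (nonpos_of_dotProduct_hidden_nonneg (j := k) hA0 (fun x _ => h x) k) ?_
  have h1 := h (A⁻¹ *ᵥ Pi.single k 1)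
  have h2 := h (A⁻¹ *ᵥ (-Pi.single k 1))
  rw [hidden_inv_mulVec hA, dotProduct_add] at h1 h2
  obtain ⟨h3, h4⟩ := rowCoeff_bounds h1 h2
  rw [Pi.zero_apply]
  linarith

/-- The rows `p` with `p · hidden A x ≥ x j` for all `x` are multiples of the standard basis vector,
by a factor of at least `1 / (1 + A j j)`. -/
lemma feasible_row (hA0 : ∀ i j, 0 ≤ A i j) (hA : IsUnit A.det) {j : Fin d} {p : Fin d → ℝ}
    (h : ∀ x, x j ≤ p ⬝ᵥ hidden A x) : (∀ k, k ≠ j → p k = 0) ∧ 1 ≤ p j * (1 + A j j) := by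
  have hpk : ∀ k, k ≠ j → p k = 0 := by
    intro k hk
    have hneg : -(Pi.single k 1 : Fin d → ℝ) ≤ 0 := neg_nonpos.2 (Pi.single_nonneg.2 zero_le_one)
    have h0 := h (-Pi.single k 1)
    rw [hidden_of_nonpos hA0 hneg, dotProduct_neg, dotProduct_single, mul_one, Pi.neg_apply,
      Pi.single_eq_of_ne hk.symm] at h0
    have h1 := h (A⁻¹ *ᵥ Pi.single k 1)
    have h2 := h (A⁻¹ *ᵥ (-Pi.single k 1))
    have hx : ∀ x : Fin d → ℝ, x j = (Pi.single j 1 : Fin d → ℝ) ⬝ᵥ x := fun x => by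
      rw [single_dotProduct, one_mul]
    rw [hx (A⁻¹ *ᵥ _), hidden_inv_mulVec hA, dotProduct_add, ← sub_nonneg, add_sub_assoc,
      ← sub_dotProduct] at h1 h2
    obtain ⟨h3, h4⟩ := rowCoeff_bounds h1 h2
    linarith
  refine ⟨hpk, ?_⟩
  have h1 := h (Pi.single j 1)
  have h2 : p ⬝ᵥ hidden A (Pi.single j 1) = p j * hidden A (Pi.single j 1) j :=
    Finset.sum_eq_single j (fun k _ hk => by rw [hpk k hk, zero_mul]) (by simp)
  rw [h2, hidden_apply, dotProduct_single, mul_one, Pi.single_eq_same,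
    max_eq_right (hA0 j j)] at h1
  linarith

end hidden

/-! ### The programs of layer 2 -/

lemma sqNorm_nonneg {p : ℕ} (v : Fin p → ℝ) : 0 ≤ sqNorm v :=
  Finset.sum_nonneg fun _ _ => sq_nonneg _

lemma sqNorm_zero {p : ℕ} : sqNorm (0 : Fin p → ℝ) = 0 := by simp [sqNorm]

lemma eq_zero_of_sqNorm_nonpos {p : ℕ} {v : Fin p → ℝ} (h : sqNorm v ≤ 0) : v = 0 := by
  have h1 := (norm_sq_le_sqNorm v).trans h
  have h2 : ‖v‖ = 0 := pow_eq_zero_iff two_ne_zero |>.1 (le_antisymm h1 (sq_nonneg _))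
  exact norm_eq_zero.1 h2

/-- A mean square error of zero means that every residual vanishes. -/
lemma eq_zero_of_mean_sqNorm_nonpos {p n : ℕ} {v : ℕ → Fin p → ℝ}
    (h : 1 / (2 * (n : ℝ)) * ∑ i ∈ Finset.range n, sqNorm (v i) ≤ 0) {i : ℕ} (hi : i < n) :
    v i = 0 := by
  have hn : (0 : ℝ) < n := by exact_mod_cast (Nat.zero_le i).trans_lt hi
  have h1 : ∑ i ∈ Finset.range n, sqNorm (v i) ≤ 0 := by
    by_contra hcon
    have : 0 < 1 / (2 * (n : ℝ)) * ∑ i ∈ Finset.range n, sqNorm (v i) :=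
      mul_pos (by positivity) (not_le.1 hcon)
    linarith
  exact eq_zero_of_sqNorm_nonpos ((Finset.single_le_sum (f := fun i => sqNorm (v i))
    (fun i _ => sqNorm_nonneg _) (Finset.mem_range.2 hi)).trans h1)

lemma mulVec_residualUnit_apply {d m : ℕ} (A : Matrix (Fin d) (Fin d) ℝ)
    (B : Matrix (Fin m) (Fin d) ℝ) (C : Matrix (Fin d) (Fin m) ℝ) (x : Fin d → ℝ) (j : Fin d) :
    (C *ᵥ residualUnit A B x) j = (C * B) j ⬝ᵥ hidden A x := by
  rw [residualUnit_eq, mulVec_mulVec]; rfl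

/-- The quadratic program has the optimal value `0`, so that it has the same solutions as the
linear program. -/
lemma IsLayer2Solution.eq_and_le {d m n : ℕ} {A : Matrix (Fin d) (Fin d) ℝ}
    {B : Matrix (Fin m) (Fin d) ℝ} {L : Matrix (Fin d) (Fin m) ℝ} (hL : L * B = 1)
    {x : ℕ → Fin d → ℝ} {C : Matrix (Fin d) (Fin m) ℝ} {Ξ : ℕ → Fin d → ℝ}
    (h : IsLayer2Solution n x (fun i => residualUnit A B (x i)) C Ξ) :
    (∀ i, Ξ i = C *ᵥ residualUnit A B (x i) - x i) ∧
      ∀ i < n, ∀ j, x i j ≤ (C * B) j ⬝ᵥ hidden A (x i) := by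
  have key : ∀ i < n, Ξ i = C *ᵥ residualUnit A B (x i) - x i ∧ 0 ≤ Ξ i := by
    rcases h.1 with ⟨h0, hmin⟩ | ⟨h0, heq⟩
    · -- the true weights and function values have objective zero
      have h1 := hmin L (fun i => relu (A *ᵥ x i)) (fun i _ j => le_max_left _ _)
      have h2 : layer2Objective n x (fun i => residualUnit A B (x i)) L
          (fun i => relu (A *ᵥ x i)) = 0 := by
        unfold layer2Objective
        rw [Finset.sum_eq_zero, mul_zero]
        intro i _
        have : L *ᵥ residualUnit A B (x i) = relu (A *ᵥ x i) + x i := by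
          rw [residualUnit, mulVec_mulVec, hL, one_mulVec]
        rw [this, sub_self, sqNorm_zero]
      rw [h2] at h1
      intro i hi
      have h3 := eq_zero_of_mean_sqNorm_nonpos h1 hi
      exact ⟨eq_sub_of_add_eq (sub_eq_zero.1 h3), h0 i hi⟩
    · intro i hi
      exact ⟨heq i hi, by rw [heq i hi]; exact h0 i hi⟩
  refine ⟨fun i => ?_, fun i hi j => ?_⟩
  · rcases lt_or_ge i n with hi | hi
    · exact (key i hi).1
    · exact h.2 i hi
  · obtain ⟨h1, h2⟩ := key i hi
    have h3 := h2 j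
    rw [h1, Pi.sub_apply, mulVec_residualUnit_apply] at h3
    exact sub_nonneg.1 h3

section layer2

variable {d : ℕ} {c : Set (Fin d → ℝ) → ℝ} {x : ℕ → Fin d → ℝ} {A : Matrix (Fin d) (Fin d) ℝ}
  {j : Fin d} {n : ℕ → ℕ} {p : ℕ → Fin d → ℝ}

/-- If `j` is not a scale component, then the constraints that are tight at the true solution pin
down the row `j` exactly after finitely many samples. -/
lemma eventually_row_eq_single (hx : IsRichSample c x)
    (hc : ∀ U, IsOpen U → U.Nonempty → 0 < c U)
    (hA0 : ∀ i j, 0 ≤ A i j) (hA : IsUnit A.det) (hj : ¬ IsScaleTransformation A j)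
    (hn : Tendsto n atTop atTop) (hp : ∀ t, ∀ i < n t, x i j ≤ p t ⬝ᵥ hidden A (x i)) :
    ∀ᶠ t in atTop, p t = Pi.single j 1 := by
  obtain ⟨n₀, r, hr, htest⟩ := exists_finite_test
    (fun i => if A j ⬝ᵥ x i < 0 then hidden A (x i) else 0) (by
      intro q hq
      refine eq_zero_of_dotProduct_hidden_nonneg hA0 hA hj fun z hz => ?_
      refine hx.nonneg_of_forall hc (O := {x | A j ⬝ᵥ x < 0})
        (isOpen_lt (by fun_prop) continuous_const) (g := fun z => q ⬝ᵥ hidden A z) (by fun_prop)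
        (fun i hi => ?_) (mem_closure_halfSpace hA hz)
      have h1 := hq i
      have hi' : A j ⬝ᵥ x i < 0 := hi
      rwa [if_pos hi'] at h1)
  filter_upwards [hn.eventually_ge_atTop n₀] with t ht
  by_contra hne
  obtain ⟨i, hi, hlt⟩ := htest (p t - Pi.single j 1) (sub_ne_zero.2 hne)
  have h0 : 0 ≤ r * ‖p t - Pi.single j 1‖ := by positivity
  split_ifs at hlt with hneg
  · have h1 := hp t i (hi.trans_le ht)
    rw [sub_dotProduct, single_dotProduct, one_mul, hidden_apply, max_eq_left hneg.le] at hlt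
    linarith
  · rw [dotProduct_zero] at hlt
    linarith

lemma exists_eventually_norm_row_le (hx : IsRichSample c x)
    (hc : ∀ U, IsOpen U → U.Nonempty → 0 < c U)
    (hA0 : ∀ i j, 0 ≤ A i j) (hA : IsUnit A.det)
    (hn : Tendsto n atTop atTop) (hp : ∀ t, ∀ i < n t, x i j ≤ p t ⬝ᵥ hidden A (x i)) :
    ∃ R, ∀ᶠ t in atTop, ‖p t‖ ≤ R := by
  obtain ⟨n₀, r, hr, htest⟩ := exists_finite_test (fun i => hidden A (x i)) (by
    intro q hq
    refine eq_zero_of_forall_dotProduct_hidden_nonneg hA0 hA fun z => ?_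
    exact hx.nonneg_of_forall hc isOpen_univ (g := fun z => q ⬝ᵥ hidden A z) (by fun_prop)
      (fun i _ => hq i) (subset_closure (Set.mem_univ z)))
  refine ⟨(∑ i ∈ Finset.range n₀, |x i j|) / r, ?_⟩
  filter_upwards [hn.eventually_ge_atTop n₀] with t ht
  by_cases h0 : p t = 0
  · rw [h0, norm_zero]; positivity
  obtain ⟨i, hi, hlt⟩ := htest (p t) h0
  have h1 := hp t i (hi.trans_le ht)
  have h2 : |x i j| ≤ ∑ i ∈ Finset.range n₀, |x i j| :=
    Finset.single_le_sum (f := fun i => |x i j|) (fun _ _ => abs_nonneg _) (Finset.mem_range.2 hi)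
  have h3 := neg_abs_le (x i j)
  rw [le_div_iff₀ hr]
  linarith

/-- The feasible rows approach multiples of the standard basis vector, with factors that stay away
from zero. -/
lemma row_asymptotics (hx : IsRichSample c x)
    (hc : ∀ U, IsOpen U → U.Nonempty → 0 < c U)
    (hA0 : ∀ i j, 0 ≤ A i j) (hA : IsUnit A.det)
    (hn : Tendsto n atTop atTop) (hp : ∀ t, ∀ i < n t, x i j ≤ p t ⬝ᵥ hidden A (x i)) :
    Tendsto (fun t => p t - p t j • (Pi.single j 1 : Fin d → ℝ)) atTop (nhds 0) ∧
      ∀ᶠ t in atTop, 1 / 2 < p t j * (1 + A j j) := by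
  obtain ⟨R, hR⟩ := exists_eventually_norm_row_le hx hc hA0 hA hn hp
  have hcluster : ∀ b, MapClusterPt b atTop p →
      (∀ k, k ≠ j → b k = 0) ∧ 1 ≤ b j * (1 + A j j) := by
    intro b hb
    refine feasible_row hA0 hA fun z => ?_
    have := hx.nonneg_of_forall hc isOpen_univ (g := fun z => b ⬝ᵥ hidden A z - z j) (by fun_prop)
      (fun i _ => ?_) (subset_closure (Set.mem_univ z))
    · linarith
    · have hclosed : IsClosed {b : Fin d → ℝ | 0 ≤ b ⬝ᵥ hidden A (x i) - x i j} :=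
        isClosed_le continuous_const (by fun_prop)
      refine hclosed.mem_of_mapClusterPt hb ?_
      filter_upwards [hn.eventually_gt_atTop i] with t ht
      exact sub_nonneg.2 (hp t i ht)
  have hK : ∀ᶠ t in atTop, p t ∈ Metric.closedBall (0 : Fin d → ℝ) R := by
    filter_upwards [hR] with t ht
    rwa [mem_closedBall_zero_iff]
  have hcomp := isCompact_closedBall (0 : Fin d → ℝ) R
  constructor
  · rw [Metric.tendsto_nhds]
    intro ε hε
    refine eventually_mem_of_mapClusterPt hcomp
      (U := {b | dist (b - b j • (Pi.single j 1 : Fin d → ℝ)) 0 < ε})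
      (isOpen_lt (by fun_prop) continuous_const) hK fun b hb => ?_
    have : b - b j • (Pi.single j 1 : Fin d → ℝ) = 0 := by
      ext k
      by_cases hk : k = j
      · subst hk; simp
      · simp [(hcluster b hb).1 k hk, hk]
    show dist _ _ < ε
    rwa [this, dist_self]
  · refine eventually_mem_of_mapClusterPt hcomp
      (U := {b | 1 / 2 < b j * (1 + A j j)})
      (isOpen_lt continuous_const (by fun_prop)) hK fun b hb => ?_
    have := (hcluster b hb).2
    rw [Set.mem_ofPred_eq]
    linarith

end layer2

/-! ### The scale factors of layer 2 -/

lemma half_le_mean_of_le_sum {s : Finset ℕ} {n : ℕ} (hs : s ⊆ Finset.range n) (hn : 0 < n)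
    {η : ℝ} (hη : 0 < η) {g : ℕ → ℝ} (h : η * n ≤ ∑ i ∈ s, g i) :
    η / 2 ≤ 1 / (2 * (s.card : ℝ)) * ∑ i ∈ s, g i := by
  have hn' : (0 : ℝ) < n := by exact_mod_cast hn
  have hcard : (s.card : ℝ) ≤ n := by
    have := Finset.card_le_card hs
    rw [Finset.card_range] at this
    exact_mod_cast this
  have hpos : 0 < (s.card : ℝ) := by
    rw [Nat.cast_pos, Finset.card_pos, Finset.nonempty_iff_ne_empty]
    rintro rfl
    rw [Finset.sum_empty] at h
    exact absurd h (not_le.2 (by positivity))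
  rw [one_div, inv_mul_eq_div, le_div_iff₀ (by positivity)]
  calc η / 2 * (2 * (s.card : ℝ)) = η * s.card := by ring
    _ ≤ η * n := by gcongr
    _ ≤ _ := h

section scale2

variable {d : ℕ} {c : Set (Fin d → ℝ) → ℝ} {x : ℕ → Fin d → ℝ} {A : Matrix (Fin d) (Fin d) ℝ}
  {j : Fin d}

lemma exists_pos_entry_of_not_isScaleTransformation (hA0 : ∀ i j, 0 ≤ A i j)
    (hj : ¬ IsScaleTransformation A j) : ∃ i, i ≠ j ∧ 0 < A j i := by
  by_contra! hcon
  refine hj ?_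
  unfold IsScaleTransformation
  ext k
  by_cases hk : k = j
  · subst hk; simp
  · simp [hk, le_antisymm (hcon k hk) (hA0 j k)]

/-- If `j` is not a scale component, then the `j`-th coordinate of `hidden A x` is not linear in
`x j` on the half-space `x j < 0`: it has slope `1` where `(A x) j ≤ 0`, and it is larger than `x j`
elsewhere. Hence the regression risk is bounded away from zero. -/
lemma exists_eventually_le_scalarRisk (hc : ∀ U, IsOpen U → U.Nonempty → 0 < c U)
    (hA0 : ∀ i j, 0 ≤ A i j) (hj : ¬ IsScaleTransformation A j) :
    ∃ ε₁ : ℝ, 0 < ε₁ ∧ ∀ x : ℕ → Fin d → ℝ, IsRichSample c x → ∀ᶠ n : ℕ in atTop, ∀ k : ℝ,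
      ε₁ ≤ scalarRisk ((Finset.range n).filter (fun i => x i j < 0)) (fun i => x i j)
        (fun i => hidden A (x i) j) k := by
  obtain ⟨l, hl, hpos⟩ := exists_pos_entry_of_not_isScaleTransformation hA0 hj
  -- a slope that is close to `1` has a large error on `U₂`, any other slope has one on `U₁`
  let U₁ : Set (Fin d → ℝ) := {x | x j < -1} ∩ {x | A j ⬝ᵥ x < 0}
  let U₂ : Set (Fin d → ℝ) := ({x | -1 < x j} ∩ {x | x j < 0}) ∩ {x | 1 < A j ⬝ᵥ x}
  have hU₁ : IsOpen U₁ := (isOpen_lt (by fun_prop) (by fun_prop)).inter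
    (isOpen_lt (by fun_prop) (by fun_prop))
  have hU₂ : IsOpen U₂ := ((isOpen_lt (by fun_prop) (by fun_prop)).inter
    (isOpen_lt (by fun_prop) (by fun_prop))).inter (isOpen_lt (by fun_prop) (by fun_prop))
  have hne₁ : U₁.Nonempty := by
    refine ⟨fun _ => -2, show (-2 : ℝ) < -1 by norm_num, ?_⟩
    show ∑ k, A j k * (-2) < 0
    rw [← Finset.sum_mul]
    have : A j l ≤ ∑ k, A j k :=
      Finset.single_le_sum (f := fun k => A j k) (fun k _ => hA0 j k) (Finset.mem_univ l)
    linarith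
  have hne₂ : U₂.Nonempty := by
    refine ⟨Pi.single l ((2 + A j j) / A j l) + Pi.single j (-1 / 2), ⟨?_, ?_⟩, ?_⟩
    · show -1 < (Pi.single l _ + Pi.single j _ : Fin d → ℝ) j
      rw [Pi.add_apply, Pi.single_eq_of_ne hl.symm, Pi.single_eq_same]; norm_num
    · show (Pi.single l _ + Pi.single j _ : Fin d → ℝ) j < 0
      rw [Pi.add_apply, Pi.single_eq_of_ne hl.symm, Pi.single_eq_same]; norm_num
    · show 1 < A j ⬝ᵥ _
      rw [dotProduct_add, dotProduct_single, dotProduct_single, mul_div_cancel₀ _ hpos.ne']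
      linarith [hA0 j j]
  have hc₁ := hc U₁ hU₁ hne₁
  have hc₂ := hc U₂ hU₂ hne₂
  refine ⟨min (1 / 4 * c U₁ / 2) (1 / 4 * c U₂ / 2), by positivity, fun x hx => ?_⟩
  filter_upwards [hx.eventually_le_sum hU₁ hne₁ (η := 1 / 4) (by norm_num),
    hx.eventually_le_sum hU₂ hne₂ (η := 1 / 4) (by norm_num), eventually_gt_atTop 0]
    with n h₁ h₂ hn k
  have hs := Finset.filter_subset (fun i => x i j < 0) (Finset.range n)
  have hg0 : ∀ i, 0 ≤ if x i j < 0 then (k * x i j - hidden A (x i) j) ^ 2 else 0 := fun i => by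
    split_ifs
    exacts [sq_nonneg _, le_rfl]
  by_cases hk : 1 / 2 ≤ |k - 1|
  · refine (min_le_left _ _).trans (half_le_mean_of_le_sum hs hn (by positivity) ?_)
    rw [Finset.sum_filter]
    refine h₁ _ hg0 fun i hi => ?_
    have hi1 : x i j < -1 := hi.1
    have hi2 : A j ⬝ᵥ x i < 0 := hi.2
    beta_reduce
    rw [if_pos (by linarith), hidden_apply, max_eq_left hi2.le, zero_add]
    have h3 : 1 / 4 ≤ (k - 1) ^ 2 := by
      rw [← sq_abs]; nlinarith
    have h4 : 1 ≤ x i j ^ 2 := by nlinarith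
    nlinarith
  · refine (min_le_right _ _).trans (half_le_mean_of_le_sum hs hn (by positivity) ?_)
    rw [Finset.sum_filter]
    refine h₂ _ hg0 fun i hi => ?_
    have hi1 : -1 < x i j := hi.1.1
    have hi2 : x i j < 0 := hi.1.2
    have hi3 : 1 < A j ⬝ᵥ x i := hi.2
    beta_reduce
    rw [if_pos hi2, hidden_apply, max_eq_right (by linarith)]
    have h3 : (k - 1) * x i j ≤ 1 / 2 := by
      refine (le_abs_self _).trans ?_
      rw [abs_mul]
      have : |x i j| ≤ 1 := abs_le.2 ⟨hi1.le, by linarith⟩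
      nlinarith [abs_nonneg (k - 1), abs_nonneg (x i j)]
    nlinarith

lemma hidden_apply_of_isScaleTransformation (hA0 : ∀ i j, 0 ≤ A i j)
    (hj : IsScaleTransformation A j) {z : Fin d → ℝ} (hz : z j < 0) : hidden A z j = z j := by
  have h1 : A j ⬝ᵥ z = A j j * z j := by
    have h2 : A j = A j j • (Pi.single j 1 : Fin d → ℝ) := hj
    rw [h2, smul_dotProduct, single_dotProduct, one_mul, smul_eq_mul]
    simp
  rw [hidden_apply, h1, max_eq_left (mul_nonpos_of_nonneg_of_nonpos (hA0 j j) hz.le), zero_add]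

/-- For a scale component the regression of `p · hidden A x` on `x j` has the slope `p j` up to an
error that is controlled by the entries of `p` off `j`. -/
lemma exists_scalarLR_bound (hx : IsRichSample c x)
    (hc : ∀ U, IsOpen U → U.Nonempty → 0 < c U) (hA0 : ∀ i j, 0 ≤ A i j)
    (hj : IsScaleTransformation A j) :
    ∃ Q : ℝ, 0 < Q ∧ ∀ᶠ n : ℕ in atTop, ∀ (p : Fin d → ℝ) (k : ℝ),
      IsScalarLR ((Finset.range n).filter (fun i => x i j < 0)) (fun i => x i j)
        (fun i => p ⬝ᵥ hidden A (x i)) k →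
      scalarRisk ((Finset.range n).filter (fun i => x i j < 0)) (fun i => x i j)
        (fun i => p ⬝ᵥ hidden A (x i)) k ≤ Q * ‖p - p j • (Pi.single j 1 : Fin d → ℝ)‖ ^ 2 ∧
      (k - p j) ^ 2 ≤ Q * ‖p - p j • (Pi.single j 1 : Fin d → ℝ)‖ ^ 2 := by
  obtain ⟨F, hF, hFle⟩ := exists_norm_hidden_le A
  obtain ⟨K, hK, hKle⟩ := hx.energy
  have hU₁ : IsOpen {z : Fin d → ℝ | z j < 0} := isOpen_lt (by fun_prop) (by fun_prop)
  have hU₂ : IsOpen {z : Fin d → ℝ | z j < -1} := isOpen_lt (by fun_prop) (by fun_prop)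
  have hne₂ : {z : Fin d → ℝ | z j < -1}.Nonempty := ⟨fun _ => -2, show (-2 : ℝ) < -1 by norm_num⟩
  have hne₁ : {z : Fin d → ℝ | z j < 0}.Nonempty := ⟨fun _ => -2, show (-2 : ℝ) < 0 by norm_num⟩
  have hc₁ := hc _ hU₁ hne₁
  have hc₂ := hc _ hU₂ hne₂
  set c₁ := c {z : Fin d → ℝ | z j < 0}
  set c₂ := c {z : Fin d → ℝ | z j < -1}
  set Q₀ : ℝ := (d * F) ^ 2 * K / c₁ with hQ₀
  have hQ₀0 : 0 ≤ Q₀ := by positivity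
  refine ⟨Q₀ + 8 * Q₀ / c₂ + 1, by positivity, ?_⟩
  filter_upwards [hKle, hx.eventually_le_sum hU₁ hne₁ (η := 1) zero_le_one,
    hx.eventually_le_sum hU₂ hne₂ (η := 1) zero_le_one, eventually_gt_atTop 0]
    with n hKn h₁ h₂ hn p k hk
  have hn' : (0 : ℝ) < n := by exact_mod_cast hn
  set s := (Finset.range n).filter (fun i => x i j < 0) with hs
  set e := p - p j • (Pi.single j 1 : Fin d → ℝ) with he
  have hcard : c₁ * n ≤ s.card := by
    have := h₁ (fun i => if x i j < 0 then 1 else 0)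
      (fun i => by split_ifs <;> norm_num)
      (fun i hi => by
        have hi' : x i j < 0 := hi
        rw [if_pos hi'])
    rwa [one_mul, Finset.sum_boole] at this
  have hcard0 : 0 < (s.card : ℝ) := lt_of_lt_of_le (by positivity) hcard
  -- the second moment of the regressor
  have hu : c₂ / 2 ≤ 1 / (2 * (s.card : ℝ)) * ∑ i ∈ s, x i j ^ 2 := by
    refine half_le_mean_of_le_sum (Finset.filter_subset _ _) hn hc₂ ?_
    have := h₂ (fun i => if x i j < 0 then x i j ^ 2 else 0)
      (fun i => by split_ifs <;> positivity)
      (fun i hi => by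
        have hi' : x i j < -1 := hi
        rw [if_pos (by linarith)]; nlinarith)
    rwa [one_mul, ← Finset.sum_filter] at this
  -- the risk of the slope `p j`
  have hrisk : scalarRisk s (fun i => x i j) (fun i => p ⬝ᵥ hidden A (x i)) (p j)
      ≤ Q₀ * ‖e‖ ^ 2 := by
    unfold scalarRisk
    have hsum : ∑ i ∈ s, (p j * x i j - p ⬝ᵥ hidden A (x i)) ^ 2
        ≤ (d * F) ^ 2 * ‖e‖ ^ 2 * (K * n) := by
      calc ∑ i ∈ s, (p j * x i j - p ⬝ᵥ hidden A (x i)) ^ 2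
          ≤ ∑ i ∈ s, (d * F) ^ 2 * ‖e‖ ^ 2 * ‖x i‖ ^ 2 := by
            refine Finset.sum_le_sum fun i hi => ?_
            have hneg := (Finset.mem_filter.1 hi).2
            have heq : p j * x i j - p ⬝ᵥ hidden A (x i) = -(e ⬝ᵥ hidden A (x i)) := by
              rw [he, sub_dotProduct, smul_dotProduct, single_dotProduct, one_mul,
                hidden_apply_of_isScaleTransformation hA0 hj hneg, smul_eq_mul]
              ring
            rw [heq, neg_sq, ← sq_abs, ← mul_pow, ← mul_pow]
            refine pow_le_pow_left₀ (abs_nonneg _) ?_ 2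
            refine (abs_dotProduct_le _ _).trans ?_
            calc d * ‖e‖ * ‖hidden A (x i)‖ ≤ d * ‖e‖ * (F * ‖x i‖) := by
                  gcongr; exact hFle _
              _ = _ := by ring
        _ ≤ ∑ i ∈ Finset.range n, (d * F) ^ 2 * ‖e‖ ^ 2 * ‖x i‖ ^ 2 :=
            Finset.sum_le_sum_of_subset_of_nonneg (Finset.filter_subset _ _)
              fun _ _ _ => by positivity
        _ = (d * F) ^ 2 * ‖e‖ ^ 2 * ∑ i ∈ Finset.range n, ‖x i‖ ^ 2 := by rw [Finset.mul_sum]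
        _ ≤ _ := by gcongr
    rw [one_div, inv_mul_eq_div, div_le_iff₀ (by positivity)]
    refine hsum.trans ?_
    calc (d * F) ^ 2 * ‖e‖ ^ 2 * (K * n) = Q₀ * ‖e‖ ^ 2 * (c₁ * n) := by
          rw [hQ₀]; field_simp
      _ ≤ Q₀ * ‖e‖ ^ 2 * s.card := by gcongr
      _ ≤ Q₀ * ‖e‖ ^ 2 * (2 * s.card) := by
          gcongr; linarith
  have hriskk := (hk (p j)).trans hrisk
  have hsplit : 1 / (2 * (s.card : ℝ)) * ∑ i ∈ s, ((k - p j) ^ 2 * x i j ^ 2)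
      ≤ 2 * scalarRisk s (fun i => x i j) (fun i => p ⬝ᵥ hidden A (x i)) k +
        2 * scalarRisk s (fun i => x i j) (fun i => p ⬝ᵥ hidden A (x i)) (p j) := by
    unfold scalarRisk
    have : ∑ i ∈ s, ((k - p j) ^ 2 * x i j ^ 2)
        ≤ 2 * ∑ i ∈ s, (k * x i j - p ⬝ᵥ hidden A (x i)) ^ 2 +
          2 * ∑ i ∈ s, (p j * x i j - p ⬝ᵥ hidden A (x i)) ^ 2 := by
      rw [Finset.mul_sum, Finset.mul_sum, ← Finset.sum_add_distrib]
      refine Finset.sum_le_sum fun i _ => ?_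
      nlinarith [sq_nonneg (k * x i j - p ⬝ᵥ hidden A (x i) +
        (p j * x i j - p ⬝ᵥ hidden A (x i)))]
    calc _ ≤ 1 / (2 * (s.card : ℝ)) * (2 * ∑ i ∈ s, (k * x i j - p ⬝ᵥ hidden A (x i)) ^ 2 +
          2 * ∑ i ∈ s, (p j * x i j - p ⬝ᵥ hidden A (x i)) ^ 2) := by gcongr
      _ = _ := by ring
  have h8 : 0 ≤ 8 * Q₀ / c₂ := by positivity
  have he2 : 0 ≤ ‖e‖ ^ 2 := by positivity
  refine ⟨?_, ?_⟩
  · nlinarith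
  · rw [← Finset.mul_sum] at hsplit
    have h9 : (k - p j) ^ 2 * (c₂ / 2) ≤ 4 * Q₀ * ‖e‖ ^ 2 := by
      have : (k - p j) ^ 2 * (c₂ / 2)
          ≤ (k - p j) ^ 2 * (1 / (2 * (s.card : ℝ)) * ∑ i ∈ s, x i j ^ 2) := by gcongr
      linarith
    have h10 : (k - p j) ^ 2 ≤ 8 * Q₀ / c₂ * ‖e‖ ^ 2 := by
      rw [div_mul_eq_mul_div, le_div_iff₀ hc₂]
      linarith
    nlinarith

/-- After the rescaling of layer 2 the row of a scale component converges. -/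
lemma tendsto_rescaled_row {m : ℕ} {B : Matrix (Fin m) (Fin d) ℝ} (hx : IsRichSample c x)
    (hc : ∀ U, IsOpen U → U.Nonempty → 0 < c U) (hA0 : ∀ i j, 0 ≤ A i j)
    (hj : IsScaleTransformation A j) {ε : ℝ} (hε : 0 < ε) {n : ℕ → ℕ} (hn : Tendsto n atTop atTop)
    {C : ℕ → Matrix (Fin d) (Fin m) ℝ} {k : ℕ → ℝ}
    (hk : ∀ t, IsLayer2ScaleFactor ε (n t) x (fun i => residualUnit A B (x i)) (C t) j (k t))
    (hoff : Tendsto (fun t => (C t * B) j - (C t * B) j j • (Pi.single j 1 : Fin d → ℝ)) atTop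
      (nhds 0))
    (hlow : ∀ᶠ t in atTop, 1 / 2 < (C t * B) j j * (1 + A j j)) :
    Tendsto (fun t => (k t)⁻¹ • (C t * B) j) atTop (nhds (Pi.single j 1)) := by
  obtain ⟨Q, hQ, hbound⟩ := exists_scalarLR_bound hx hc hA0 hj
  set e : ℕ → Fin d → ℝ := fun t => (C t * B) j - (C t * B) j j • (Pi.single j 1 : Fin d → ℝ)
    with he
  have hQe : Tendsto (fun t => Q * ‖e t‖ ^ 2) atTop (nhds 0) := by
    have := ((hoff.norm).pow 2).const_mul Q
    simpa using this
  -- the risk falls below the tolerance, so that the regression slope is not replaced by `1`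
  have hdiff : ∀ᶠ t in atTop, |k t - (C t * B) j j| ≤ √(Q * ‖e t‖ ^ 2) := by
    filter_upwards [hn.eventually hbound, hQe.eventually_le_const hε] with t h1 h2
    obtain ⟨k₀, hLR, hkt⟩ := hk t
    simp only [mulVec_residualUnit_apply] at hLR hkt
    obtain ⟨h3, h4⟩ := h1 _ _ hLR
    rw [if_neg (not_lt.2 (h3.trans h2))] at hkt
    rw [hkt]
    exact Real.abs_le_sqrt h4
  have hdiff0 : Tendsto (fun t => k t - (C t * B) j j) atTop (nhds 0) := by
    refine squeeze_zero_norm' hdiff ?_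
    simpa using hQe.sqrt
  have ha : 0 < 1 + A j j := by linarith [hA0 j j]
  set δ : ℝ := 1 / (4 * (1 + A j j)) with hδ
  have hδ0 : 0 < δ := by positivity
  have hklow : ∀ᶠ t in atTop, δ ≤ k t := by
    filter_upwards [hlow, hdiff0.eventually_const_le (neg_lt_zero.2 hδ0)] with t h1 h2
    have h3 : 2 * δ < (C t * B) j j := by
      rw [hδ, ← div_lt_iff₀ ha] at *
      have : 2 * (1 / (4 * (1 + A j j))) = 1 / 2 / (1 + A j j) := by field_simp; norm_num
      linarith
    linarith
  have hinv : ∀ᶠ t in atTop, ‖(k t)⁻¹‖ ≤ δ⁻¹ := by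
    filter_upwards [hklow] with t ht
    rw [norm_inv, Real.norm_eq_abs, abs_of_pos (hδ0.trans_le ht)]
    exact inv_anti₀ hδ0 ht
  have hlim : Tendsto (fun t => (k t)⁻¹ • (e t - (k t - (C t * B) j j) •
      (Pi.single j 1 : Fin d → ℝ))) atTop (nhds 0) := by
    have h0 : Tendsto (fun t => e t - (k t - (C t * B) j j) • (Pi.single j 1 : Fin d → ℝ)) atTop
        (nhds 0) := by
      have := hoff.sub (hdiff0.smul_const (Pi.single j 1 : Fin d → ℝ))
      simpa using this
    refine squeeze_zero_norm' (a := fun t => δ⁻¹ *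
      ‖e t - (k t - (C t * B) j j) • (Pi.single j 1 : Fin d → ℝ)‖) ?_ ?_
    · filter_upwards [hinv] with t ht
      rw [norm_smul]
      gcongr
    · simpa using h0.norm.const_mul δ⁻¹
  have := hlim.add_const (Pi.single j 1 : Fin d → ℝ)
  rw [zero_add] at this
  refine this.congr' ?_
  filter_upwards [hklow] with t ht
  have hk0 : k t ≠ 0 := (hδ0.trans_le ht).ne'
  rw [he]
  simp only [sub_smul, smul_sub, smul_smul, inv_mul_cancel₀ hk0, one_smul]
  abel

end scale2

/-! ### The regression of the layer 2 weights -/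

section regression

variable {d m : ℕ} {c : Set (Fin d → ℝ) → ℝ} {x : ℕ → Fin d → ℝ} {A : Matrix (Fin d) (Fin d) ℝ}

/-- The regression has an exact solution, and the inputs span the space, so that the regression
inverts the matrix `D` that the rescaling left over. -/
lemma eventually_mul_eq_of_isVectorLR (hx : IsRichSample c x)
    (hc : ∀ U, IsOpen U → U.Nonempty → 0 < c U) (hA0 : ∀ i j, 0 ≤ A i j) (hA : IsUnit A.det)
    (B : Matrix (Fin m) (Fin d) ℝ) :
    ∀ᶠ n : ℕ in atTop, ∀ (D : Matrix (Fin d) (Fin d) ℝ) (B' : Matrix (Fin m) (Fin d) ℝ),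
      IsUnit D.det → IsVectorLR (Finset.range n) (fun i => D *ᵥ hidden A (x i))
        (fun i => residualUnit A B (x i)) B' → B' * D = B := by
  obtain ⟨n₀, r, hr, htest⟩ := exists_finite_test (fun i => hidden A (x i)) (by
    intro q hq
    refine eq_zero_of_forall_dotProduct_hidden_nonneg hA0 hA fun z => ?_
    exact hx.nonneg_of_forall hc isOpen_univ (g := fun z => q ⬝ᵥ hidden A z) (by fun_prop)
      (fun i _ => hq i) (subset_closure (Set.mem_univ z)))
  filter_upwards [eventually_ge_atTop n₀] with n hn D B' hD hLR
  have h1 := hLR (B * D⁻¹)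
  have h2 : vectorRisk (Finset.range n) (fun i => D *ᵥ hidden A (x i))
      (fun i => residualUnit A B (x i)) (B * D⁻¹) = 0 := by
    unfold vectorRisk
    rw [Finset.sum_eq_zero, mul_zero]
    intro i _
    beta_reduce
    rw [mulVec_mulVec, Matrix.mul_assoc, nonsing_inv_mul D hD, Matrix.mul_one, residualUnit_eq,
      sub_self, sqNorm_zero]
  rw [h2, vectorRisk, Finset.card_range] at h1
  have h3 : ∀ i < n, (B' * D - B) *ᵥ hidden A (x i) = 0 := by
    intro i hi
    have := eq_zero_of_mean_sqNorm_nonpos h1 hi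
    rwa [mulVec_mulVec, residualUnit_eq, ← sub_mulVec] at this
  rw [← sub_eq_zero]
  funext l
  by_contra hne
  obtain ⟨i, hi, hlt⟩ := htest _ hne
  have h4 : (B' * D - B) l ⬝ᵥ hidden A (x i) = 0 := congrFun (h3 i (hi.trans_le hn)) l
  rw [h4] at hlt
  have : 0 ≤ r * ‖(B' * D - B) l‖ := by positivity
  linarith

lemma tendsto_regression (hx : IsRichSample c x)
    (hc : ∀ U, IsOpen U → U.Nonempty → 0 < c U) (hA0 : ∀ i j, 0 ≤ A i j) (hA : IsUnit A.det)
    {B : Matrix (Fin m) (Fin d) ℝ} {n : ℕ → ℕ} (hn : Tendsto n atTop atTop)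
    {D : ℕ → Matrix (Fin d) (Fin d) ℝ} (hD : Tendsto D atTop (nhds 1))
    {B' : ℕ → Matrix (Fin m) (Fin d) ℝ}
    (hB : ∀ t, IsVectorLR (Finset.range (n t)) (fun i => D t *ᵥ hidden A (x i))
        (fun i => residualUnit A B (x i)) (B' t)) :
    Tendsto B' atTop (nhds B) := by
  have hinv : Tendsto (fun t => (D t)⁻¹) atTop (nhds 1) := by
    have h1 : ContinuousAt Inv.inv (1 : Matrix (Fin d) (Fin d) ℝ) := by
      refine continuousAt_matrix_inv _ ?_
      rw [det_one, Ring.inverse_eq_inv']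
      exact continuousAt_inv₀ one_ne_zero
    have h2 := h1.tendsto.comp hD
    rwa [inv_one] at h2
  have hdet : ∀ᶠ t in atTop, (D t).det ≠ 0 := by
    have h1 : Tendsto (fun t => (D t).det) atTop (nhds (1 : Matrix (Fin d) (Fin d) ℝ).det) :=
      (Continuous.matrix_det continuous_id).continuousAt.tendsto.comp hD
    rw [det_one] at h1
    exact h1.eventually_ne one_ne_zero
  have hmul : Continuous fun E : Matrix (Fin d) (Fin d) ℝ => B * E :=
    continuous_const.matrix_mul continuous_id
  have hlim : Tendsto (fun t => B * (D t)⁻¹) atTop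
      (nhds (B * (1 : Matrix (Fin d) (Fin d) ℝ))) :=
    (hmul.tendsto 1).comp hinv
  rw [Matrix.mul_one] at hlim
  refine hlim.congr' ?_
  filter_upwards [hn.eventually (eventually_mul_eq_of_isVectorLR hx hc hA0 hA B), hdet] with t h1 h2
  have hu : IsUnit (D t).det := isUnit_iff_ne_zero.2 h2
  rw [← h1 (D t) (B' t) hu (hB t), Matrix.mul_assoc, mul_nonsing_inv _ hu, Matrix.mul_one]

end regression

/-! ### The programs and the regression of layer 1 -/

lemma sqNorm_update {p : ℕ} (v : Fin p → ℝ) (j : Fin p) (b : ℝ) :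
    sqNorm (Function.update v j b) + v j ^ 2 = sqNorm v + b ^ 2 := by
  unfold sqNorm
  rw [← Finset.add_sum_erase _ _ (Finset.mem_univ j),
    ← Finset.add_sum_erase (f := fun l => v l ^ 2) _ (Finset.mem_univ j), Function.update_self,
    Finset.sum_congr rfl fun l hl => by rw [Function.update_of_ne (Finset.ne_of_mem_erase hl)]]
  ring

/-- Each row of a layer 1 solution violates its constraints by no more than the zero row does: the
quadratic program splits into independent programs for the rows, and solutions of the linear program
violate no constraint. -/
lemma IsLayer1Solution.sum_sq_le {d n : ℕ} {x h : ℕ → Fin d → ℝ} {A' : Matrix (Fin d) (Fin d) ℝ}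
    (hA' : IsLayer1Solution n x h A') (j : Fin d) :
    ∑ i ∈ Finset.range n, max 0 (A' j ⬝ᵥ x i - h i j) ^ 2
      ≤ ∑ i ∈ Finset.range n, max 0 (-h i j) ^ 2 := by
  rcases hA' with ⟨Φ, h0, hmin⟩ | hLP
  · rcases Nat.eq_zero_or_pos n with rfl | hn
    · simp
    have hn' : (0 : ℝ) < n := by exact_mod_cast hn
    -- the competitor: row `j` is replaced by zero, with the best slack for it
    have h1 := hmin (A'.updateRow j 0) (fun i => Function.update (Φ i) j (max 0 (h i j))) (by
      intro i hi l
      by_cases hl : l = j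
      · subst hl; simp
      · simpa [hl] using h0 i hi l)
    unfold layer1Objective at h1
    have h2 := le_of_mul_le_mul_left h1 (by positivity)
    have h3 : ∀ i, Function.update (Φ i) j (max 0 (h i j)) + A'.updateRow j 0 *ᵥ x i - h i =
        Function.update (Φ i + A' *ᵥ x i - h i) j (max 0 (-h i j)) := by
      intro i
      ext l
      by_cases hl : l = j
      · subst hl
        have h4 : (A'.updateRow l 0 *ᵥ x i) l = 0 := by
          rw [mulVec, updateRow_self, zero_dotProduct]
        rw [Pi.sub_apply, Pi.add_apply, h4, Function.update_self, Function.update_self, add_zero]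
        rcases le_total 0 (h i l) with hh | hh
        · rw [max_eq_right hh, max_eq_left (by linarith)]; ring
        · rw [max_eq_left hh, max_eq_right (by linarith)]; ring
      · have h4 : (A'.updateRow j 0 *ᵥ x i) l = (A' *ᵥ x i) l := by
          rw [mulVec, updateRow_ne hl]; rfl
        simp only [Pi.sub_apply, Pi.add_apply, h4, Function.update_of_ne hl]
    simp only [h3] at h2
    have h5 : ∑ i ∈ Finset.range n, (Φ i + A' *ᵥ x i - h i) j ^ 2
        ≤ ∑ i ∈ Finset.range n, max 0 (-h i j) ^ 2 := by
      have h6 : ∑ i ∈ Finset.range n, (sqNorm (Function.update (Φ i + A' *ᵥ x i - h i) j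
          (max 0 (-h i j))) + (Φ i + A' *ᵥ x i - h i) j ^ 2) =
          ∑ i ∈ Finset.range n, (sqNorm (Φ i + A' *ᵥ x i - h i) + max 0 (-h i j) ^ 2) :=
        Finset.sum_congr rfl fun i _ => sqNorm_update _ _ _
      rw [Finset.sum_add_distrib, Finset.sum_add_distrib] at h6
      linarith
    refine le_trans (Finset.sum_le_sum fun i hi => ?_) h5
    have hΦ : 0 ≤ Φ i j := h0 i (Finset.mem_range.1 hi) j
    have h7 : (Φ i + A' *ᵥ x i - h i) j = Φ i j + (A' j ⬝ᵥ x i - h i j) := by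
      rw [add_sub_assoc]; rfl
    rw [h7]
    rcases le_total 0 (A' j ⬝ᵥ x i - h i j) with hh | hh
    · rw [max_eq_right hh]; nlinarith
    · rw [max_eq_left hh]; nlinarith [sq_nonneg (Φ i j + (A' j ⬝ᵥ x i - h i j))]
  · refine Finset.sum_le_sum fun i hi => ?_
    have h1 : 0 ≤ h i j - A' j ⬝ᵥ x i := hLP i (Finset.mem_range.1 hi) j
    rw [max_eq_left (by linarith)]
    exact pow_le_pow_left₀ le_rfl (le_max_left _ _) 2

lemma IsScalarLR.normal_equation {s : Finset ℕ} {u v : ℕ → ℝ} {k : ℝ} (h : IsScalarLR s u v k) :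
    k * ∑ i ∈ s, u i ^ 2 = ∑ i ∈ s, v i * u i := by
  rcases s.eq_empty_or_nonempty with rfl | hs
  · simp
  have hcard : 0 < (s.card : ℝ) := by exact_mod_cast hs.card_pos
  set α := ∑ i ∈ s, u i ^ 2 with hα
  set β := ∑ i ∈ s, v i * u i with hβ
  have hα0 : 0 ≤ α := Finset.sum_nonneg fun _ _ => sq_nonneg _
  have key : ∀ e : ℝ, 0 ≤ e ^ 2 * α + 2 * e * (k * α - β) := by
    intro e
    have h1 := le_of_mul_le_mul_left (h (k + e)) (by positivity)
    have h2 : ∑ i ∈ s, ((k + e) * u i - v i) ^ 2 =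
        ∑ i ∈ s, (k * u i - v i) ^ 2 + (e ^ 2 * α + 2 * e * (k * α - β)) := by
      rw [hα, hβ, Finset.mul_sum, Finset.mul_sum, ← Finset.sum_sub_distrib, Finset.mul_sum,
        ← Finset.sum_add_distrib, ← Finset.sum_add_distrib]
      exact Finset.sum_congr rfl fun i _ => by ring
    linarith
  have h3 := key (-(k * α - β) / (α + 1))
  have h4 : (-(k * α - β) / (α + 1)) ^ 2 * α + 2 * (-(k * α - β) / (α + 1)) * (k * α - β) =
      -((k * α - β) ^ 2 * ((α + 2) / (α + 1) ^ 2)) := by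
    field_simp; ring
  rw [h4] at h3
  have h5 : 0 < (α + 2) / (α + 1) ^ 2 := by positivity
  have h6 : (k * α - β) ^ 2 = 0 := by nlinarith [sq_nonneg (k * α - β)]
  exact sub_eq_zero.1 (pow_eq_zero_iff two_ne_zero |>.1 h6)

lemma IsLayer1ScaleFactor.normal_equation {d n : ℕ} {x h : ℕ → Fin d → ℝ}
    {A' : Matrix (Fin d) (Fin d) ℝ} {j : Fin d} {k : ℝ} (hk : IsLayer1ScaleFactor n x h A' j k) :
    k * ∑ i ∈ Finset.range n, max 0 (h i j) ^ 2 =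
      ∑ i ∈ Finset.range n, (A' j ⬝ᵥ x i) * max 0 (h i j) := by
  have h1 := IsScalarLR.normal_equation hk
  rw [Finset.sum_filter, Finset.sum_filter] at h1
  refine (congrArg (k * ·) (Finset.sum_congr rfl fun i _ => ?_)).trans
    (h1.trans (Finset.sum_congr rfl fun i _ => ?_))
  · split_ifs with hi
    · rw [max_eq_right hi.le]
    · rw [max_eq_left (not_lt.1 hi)]; norm_num
  · split_ifs with hi
    · rw [max_eq_right hi.le]; rfl
    · rw [max_eq_left (not_lt.1 hi), mul_zero]

section layer1

variable {d : ℕ} {c : Set (Fin d → ℝ) → ℝ} {x : ℕ → Fin d → ℝ} {A : Matrix (Fin d) (Fin d) ℝ}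
  {j : Fin d} {n : ℕ → ℕ} {h : ℕ → ℕ → ℝ} {δ : ℕ → ℝ} {a : ℕ → Fin d → ℝ} {k : ℕ → ℝ}

/-- The last regression does not degenerate: its regressor keeps a positive second moment. -/
lemma exists_eventually_le_sum_sq (hx : IsRichSample c x)
    (hc : ∀ U, IsOpen U → U.Nonempty → 0 < c U) (hA : IsUnit A.det)
    (hn : Tendsto n atTop atTop) (hδ : Tendsto δ atTop (nhds 0))
    (hh : ∀ t i, |h t i - max 0 (A j ⬝ᵥ x i)| ≤ δ t * ‖x i‖) :
    ∃ s : ℝ, 0 < s ∧ ∀ᶠ t in atTop, s * n t ≤ ∑ i ∈ Finset.range (n t), max 0 (h t i) ^ 2 := by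
  set z : Fin d → ℝ := (2 : ℝ) • (A⁻¹ *ᵥ Pi.single j 1) with hz
  let U : Set (Fin d → ℝ) := {x | 1 < A j ⬝ᵥ x} ∩ {x | ‖x‖ < ‖z‖ + 1}
  have hU : IsOpen U := (isOpen_lt (by fun_prop) (by fun_prop)).inter
    (isOpen_lt (by fun_prop) (by fun_prop))
  have hne : U.Nonempty := by
    refine ⟨z, ?_, lt_add_one ‖z‖⟩
    show 1 < A j ⬝ᵥ z
    rw [hz, dotProduct_smul, row_dotProduct_inv_mulVec hA, Pi.single_eq_same]
    norm_num
  refine ⟨1 / 4 * c U, by have := hc U hU hne; positivity, ?_⟩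
  have hδ' : ∀ᶠ t in atTop, δ t * (‖z‖ + 1) < 1 / 2 := by
    have := hδ.mul_const (‖z‖ + 1)
    rw [zero_mul] at this
    exact this.eventually_lt_const (by norm_num)
  filter_upwards [hn.eventually (hx.eventually_le_sum hU hne (η := 1 / 4) (by norm_num)), hδ']
    with t ht hδt
  refine ht _ (fun i => sq_nonneg _) fun i hi => ?_
  have hi1 : 1 < A j ⬝ᵥ x i := hi.1
  have hi2 : ‖x i‖ < ‖z‖ + 1 := hi.2
  have h1 := hh t i
  rw [max_eq_right (by linarith)] at h1
  have hz0 : 0 ≤ ‖z‖ := norm_nonneg z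
  have h2 : δ t * ‖x i‖ ≤ 1 / 2 := by
    rcases le_total 0 (δ t) with h0 | h0
    · nlinarith
    · nlinarith [norm_nonneg (x i)]
  have h3 := (abs_le.1 h1).1
  have h4 : 1 / 2 ≤ max 0 (h t i) := le_trans (by linarith) (le_max_right _ _)
  nlinarith

/-- If the rows `a t` approach the line spanned by `A j`, then the slope of the regression of
`a t · x` on the hidden outputs is asymptotically the coefficient of `A j` in `a t`. -/
lemma tendsto_slope_sub_rowCoeff (hx : IsRichSample c x)
    (hc : ∀ U, IsOpen U → U.Nonempty → 0 < c U) (hA : IsUnit A.det)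
    (hn : Tendsto n atTop atTop) (hδ : Tendsto δ atTop (nhds 0))
    (hh : ∀ t i, |h t i - max 0 (A j ⬝ᵥ x i)| ≤ δ t * ‖x i‖)
    {R : ℝ} (hR : ∀ᶠ t in atTop, ‖a t‖ ≤ R)
    (hray : Tendsto (fun t => a t - rowCoeff A j (a t) • A j) atTop (nhds 0))
    (hk : ∀ t, k t * ∑ i ∈ Finset.range (n t), max 0 (h t i) ^ 2 =
      ∑ i ∈ Finset.range (n t), (a t ⬝ᵥ x i) * max 0 (h t i)) :
    Tendsto (fun t => k t - rowCoeff A j (a t)) atTop (nhds 0) := by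
  obtain ⟨s, hs, hsle⟩ := exists_eventually_le_sum_sq hx hc hA hn hδ hh
  obtain ⟨K, hK, hKle⟩ := hx.energy
  set e : ℕ → Fin d → ℝ := fun t => a t - rowCoeff A j (a t) • A j with he
  set W : ℝ := d * R * ‖A⁻¹ *ᵥ Pi.single j (1 : ℝ)‖ with hW
  set G : ℕ → ℝ := fun t => d * ‖A j‖ + |δ t| with hG
  have hlim : Tendsto (fun t => (d * ‖e t‖ * G t + W * (|δ t| * G t)) * K / s) atTop (nhds 0) := by
    have hδa : Tendsto (fun t => |δ t|) atTop (nhds 0) := by simpa using hδ.abs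
    have hGl : Tendsto G atTop (nhds (d * ‖A j‖ + 0)) := hδa.const_add _
    have h1 := ((hray.norm.const_mul (d : ℝ)).mul hGl).add ((hδa.mul hGl).const_mul W)
    have h2 := (h1.mul_const K).div_const s
    simpa using h2
  refine squeeze_zero_norm' ?_ hlim
  filter_upwards [hR, hsle, hn.eventually hKle, hn.eventually_gt_atTop 0] with t hRt hst hKt hnt
  have hn' : (0 : ℝ) < n t := by exact_mod_cast hnt
  set l := rowCoeff A j (a t) with hl
  have hlW : |l| ≤ W := by
    refine (abs_dotProduct_le _ _).trans ?_
    rw [hW]; gcongr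
  have hG0 : 0 ≤ G t := by positivity
  have hterm : ∀ i, |(a t ⬝ᵥ x i - l * max 0 (h t i)) * max 0 (h t i)|
      ≤ (d * ‖e t‖ * G t + W * (|δ t| * G t)) * ‖x i‖ ^ 2 := by
    intro i
    have hx0 : 0 ≤ ‖x i‖ := norm_nonneg _
    have hδi : δ t * ‖x i‖ ≤ |δ t| * ‖x i‖ := mul_le_mul_of_nonneg_right (le_abs_self _) hx0
    have hδ0 : 0 ≤ |δ t| * ‖x i‖ := by positivity
    have h1 : |max 0 (h t i) - max 0 (A j ⬝ᵥ x i)| ≤ |δ t| * ‖x i‖ := by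
      have h2 := abs_max_sub_max_le_abs (h t i) (max 0 (A j ⬝ᵥ x i)) 0
      rw [max_comm _ 0, max_comm _ 0, max_eq_right (le_max_left 0 (A j ⬝ᵥ x i))] at h2
      exact h2.trans ((hh t i).trans hδi)
    have hα := abs_dotProduct_le (A j) (x i)
    have hm0 : 0 ≤ max 0 (h t i) := le_max_left _ _
    obtain ⟨h1l, h1r⟩ := abs_le.1 h1
    obtain ⟨hαl, hαr⟩ := abs_le.1 hα
    have hGx : G t * ‖x i‖ = d * ‖A j‖ * ‖x i‖ + |δ t| * ‖x i‖ := by rw [hG]; ring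
    have hαm : max 0 (A j ⬝ᵥ x i) ≤ d * ‖A j‖ * ‖x i‖ := max_le (by positivity) hαr
    have hmG : max 0 (h t i) ≤ G t * ‖x i‖ := by linarith
    have h3 : |(A j ⬝ᵥ x i - max 0 (h t i)) * max 0 (h t i)|
        ≤ (|δ t| * ‖x i‖) * (G t * ‖x i‖) := by
      rw [abs_mul, abs_of_nonneg hm0]
      rcases le_total 0 (A j ⬝ᵥ x i) with h0 | h0
      · rw [max_eq_right h0, abs_sub_comm] at h1
        exact mul_le_mul h1 hmG hm0 hδ0
      · -- on the wrong side of the hyperplane the hidden output is small, but not the regressand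
        rw [max_eq_left h0, sub_zero] at h1r
        rw [mul_comm]
        refine mul_le_mul h1r ?_ (abs_nonneg _) hδ0
        rw [abs_le]
        constructor <;> linarith
    have h4 : a t ⬝ᵥ x i = e t ⬝ᵥ x i + l * (A j ⬝ᵥ x i) := by
      rw [he, sub_dotProduct, smul_dotProduct, smul_eq_mul]; ring
    have h5 : (a t ⬝ᵥ x i - l * max 0 (h t i)) * max 0 (h t i) =
        (e t ⬝ᵥ x i) * max 0 (h t i) + l * ((A j ⬝ᵥ x i - max 0 (h t i)) * max 0 (h t i)) := by
      rw [h4]; ring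
    rw [h5]
    calc _ ≤ |(e t ⬝ᵥ x i) * max 0 (h t i)| +
          |l * ((A j ⬝ᵥ x i - max 0 (h t i)) * max 0 (h t i))| := abs_add_le _ _
      _ ≤ (d * ‖e t‖ * ‖x i‖) * (G t * ‖x i‖) + W * ((|δ t| * ‖x i‖) * (G t * ‖x i‖)) := by
          rw [abs_mul, abs_mul l, abs_of_nonneg hm0]
          have := abs_dotProduct_le (e t) (x i)
          gcongr
          exact (abs_nonneg _).trans hlW
      _ = _ := by ring
  set S := ∑ i ∈ Finset.range (n t), max 0 (h t i) ^ 2 with hS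
  have hdiff : (k t - l) * S = ∑ i ∈ Finset.range (n t),
      (a t ⬝ᵥ x i - l * max 0 (h t i)) * max 0 (h t i) := by
    rw [sub_mul, hk t, hS, Finset.mul_sum, ← Finset.sum_sub_distrib]
    exact Finset.sum_congr rfl fun i _ => by ring
  have hbound : |k t - l| * S ≤ (d * ‖e t‖ * G t + W * (|δ t| * G t)) * (K * n t) := by
    have hS0 : 0 ≤ S := Finset.sum_nonneg fun _ _ => sq_nonneg _
    rw [← abs_of_nonneg hS0, ← abs_mul, hdiff]
    refine (Finset.abs_sum_le_sum_abs _ _).trans ((Finset.sum_le_sum fun i _ => hterm i).trans ?_)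
    rw [← Finset.mul_sum]
    have : 0 ≤ W := (abs_nonneg _).trans hlW
    gcongr
  rw [Real.norm_eq_abs, le_div_iff₀ hs]
  have h6 : |k t - l| * (s * n t) ≤ |k t - l| * S := by gcongr
  refine le_of_mul_le_mul_right ?_ hn'
  linarith

lemma tendsto_inv_slope_smul
    (hray : Tendsto (fun t => a t - rowCoeff A j (a t) • A j) atTop (nhds 0))
    (hslope : Tendsto (fun t => k t - rowCoeff A j (a t)) atTop (nhds 0))
    {b : ℝ} (hb : 0 < b) (hlow : ∀ᶠ t in atTop, b ≤ |k t|) :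
    Tendsto (fun t => (k t)⁻¹ • a t) atTop (nhds (A j)) := by
  have h0 : Tendsto (fun t => (k t)⁻¹ • (a t - rowCoeff A j (a t) • A j -
      (k t - rowCoeff A j (a t)) • A j)) atTop (nhds 0) := by
    have h1 : Tendsto (fun t => a t - rowCoeff A j (a t) • A j -
        (k t - rowCoeff A j (a t)) • A j) atTop (nhds 0) := by
      simpa using hray.sub (hslope.smul_const (A j))
    refine squeeze_zero_norm' (a := fun t => b⁻¹ * ‖a t - rowCoeff A j (a t) • A j -
      (k t - rowCoeff A j (a t)) • A j‖) ?_ ?_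
    · filter_upwards [hlow] with t ht
      rw [norm_smul, norm_inv, Real.norm_eq_abs]
      gcongr
    · simpa using h1.norm.const_mul b⁻¹
  have h2 := h0.add_const (A j)
  rw [zero_add] at h2
  refine h2.congr' ?_
  filter_upwards [hlow] with t ht
  have hk0 : k t ≠ 0 := abs_pos.1 (hb.trans_le ht)
  simp only [sub_smul, smul_sub, smul_smul, inv_mul_cancel₀ hk0, one_smul]
  abel

/-- Rows that violate the constraints `b · x ≤ (A j · x)⁺` by an amount that vanishes in mean square
have no cluster points that violate a constraint. -/
lemma le_of_mapClusterPt (hx : IsRichSample c x) (hc : ∀ U, IsOpen U → U.Nonempty → 0 < c U)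
    (hn : Tendsto n atTop atTop)
    (hφ : ∀ η > 0, ∀ᶠ t in atTop, ∑ i ∈ Finset.range (n t),
      max 0 (a t ⬝ᵥ x i - max 0 (A j ⬝ᵥ x i)) ^ 2 ≤ η * n t)
    {b : Fin d → ℝ} (hb : MapClusterPt b atTop a) (z : Fin d → ℝ) :
    b ⬝ᵥ z ≤ max 0 (A j ⬝ᵥ z) := by
  by_contra! hcon
  obtain ⟨η, hη0, hη⟩ : ∃ η > 0, η < b ⬝ᵥ z - max 0 (A j ⬝ᵥ z) := exists_between (sub_pos.2 hcon)
  have hopen : IsOpen {q : (Fin d → ℝ) × (Fin d → ℝ) | η < q.1 ⬝ᵥ q.2 - max 0 (A j ⬝ᵥ q.2)} :=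
    isOpen_lt (by fun_prop) (by fun_prop)
  obtain ⟨V, U, hV, hU, hbV, hzU, hsub⟩ := isOpen_prod_iff.1 hopen b z hη
  have hcU := hc U hU ⟨z, hzU⟩
  have hfreq : ∃ᶠ t in atTop, a t ∈ V := hb.frequently (hV.mem_nhds hbV)
  obtain ⟨t, ht, h1, h2, h3⟩ := (hfreq.and_eventually
    ((hn.eventually (hx.eventually_le_sum hU ⟨z, hzU⟩ (η := η ^ 2) (by positivity))).and
      ((hφ (η ^ 2 * c U / 2) (by positivity)).and (hn.eventually_gt_atTop 0)))).exists
  have h4 := h1 (fun i => max 0 (a t ⬝ᵥ x i - max 0 (A j ⬝ᵥ x i)) ^ 2) (fun _ => sq_nonneg _)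
    (fun i hi => by
      have h5 : η < a t ⬝ᵥ x i - max 0 (A j ⬝ᵥ x i) := hsub (Set.mk_mem_prod ht hi)
      exact pow_le_pow_left₀ hη0.le (h5.le.trans (le_max_right _ _)) 2)
  have h5 : (0 : ℝ) < n t := by exact_mod_cast h3
  have h6 : 0 < η ^ 2 * c U * n t := by positivity
  linarith

/-- Rows with asymptotically vanishing violations are bounded and approach the line spanned by
`A j`. Boundedness follows from convexity: shrinking a row shrinks its violations, so that rows far
out would yield cluster points of norm `‖A j‖ + 1`. -/
lemma bounded_and_tendsto_line (hx : IsRichSample c x)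
    (hc : ∀ U, IsOpen U → U.Nonempty → 0 < c U) (hA : IsUnit A.det)
    (hn : Tendsto n atTop atTop)
    (hφ : ∀ η > 0, ∀ᶠ t in atTop, ∑ i ∈ Finset.range (n t),
      max 0 (a t ⬝ᵥ x i - max 0 (A j ⬝ᵥ x i)) ^ 2 ≤ η * n t) :
    (∀ᶠ t in atTop, ‖a t‖ ≤ ‖A j‖ + 1) ∧
      Tendsto (fun t => a t - rowCoeff A j (a t) • A j) atTop (nhds 0) := by
  have hcluster : ∀ a' : ℕ → Fin d → ℝ, (∀ η > 0, ∀ᶠ t in atTop, ∑ i ∈ Finset.range (n t),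
      max 0 (a' t ⬝ᵥ x i - max 0 (A j ⬝ᵥ x i)) ^ 2 ≤ η * n t) →
      ∀ b, MapClusterPt b atTop a' → b = rowCoeff A j b • A j ∧ ‖b‖ ≤ ‖A j‖ := by
    intro a' ha' b hb
    have h1 := le_of_mapClusterPt hx hc hn ha' hb
    obtain ⟨h2, h3⟩ := eq_rowCoeff_smul_of_halfSpace hA fun z hz => by
      have := h1 z
      rwa [max_eq_left hz] at this
    refine ⟨h3, ?_⟩
    have h4 := rowCoeff_le_one hA h1
    calc ‖b‖ = rowCoeff A j b * ‖A j‖ := by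
          conv_lhs => rw [h3]
          rw [norm_smul, Real.norm_eq_abs, abs_of_nonneg h2]
      _ ≤ 1 * ‖A j‖ := by gcongr
      _ = _ := one_mul _
  set R := ‖A j‖ + 1 with hR
  have hR0 : 0 < R := by positivity
  -- the largest factor up to `1` that brings the row into the ball of radius `R`
  set σ : ℕ → ℝ := fun t => min 1 (R / ‖a t‖) with hσ
  have hσ0 : ∀ t, 0 ≤ σ t := fun t => le_min zero_le_one (by positivity)
  have hσ1 : ∀ t, σ t ≤ 1 := fun t => min_le_left _ _
  have hbR : ∀ t, ‖σ t • a t‖ ≤ R := by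
    intro t
    rw [norm_smul, Real.norm_eq_abs, abs_of_nonneg (hσ0 t)]
    rcases eq_or_ne ‖a t‖ 0 with h0 | h0
    · rw [h0, mul_zero]; exact hR0.le
    · calc σ t * ‖a t‖ ≤ R / ‖a t‖ * ‖a t‖ := by gcongr; exact min_le_right _ _
        _ = R := div_mul_cancel₀ _ h0
  have hbounded : ∀ᶠ t in atTop, ‖a t‖ ≤ R := by
    have h1 := eventually_mem_of_mapClusterPt (isCompact_closedBall (0 : Fin d → ℝ) R)
      (U := {b | ‖b‖ < R}) (isOpen_lt (by fun_prop) (by fun_prop)) (a := fun t => σ t • a t)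
      (Eventually.of_forall fun t => mem_closedBall_zero_iff.2 (hbR t)) (fun b hb => by
        have h2 := (hcluster _ (fun η hη => by
          filter_upwards [hφ η hη] with t ht
          refine le_trans (Finset.sum_le_sum fun i _ => ?_) ht
          refine pow_le_pow_left₀ (le_max_left _ _) ?_ 2
          rw [smul_dotProduct, smul_eq_mul]
          refine max_le (le_max_left _ _) ?_
          have h3 : 0 ≤ max 0 (A j ⬝ᵥ x i) := le_max_left _ _
          have h4 : a t ⬝ᵥ x i - max 0 (A j ⬝ᵥ x i)
            ≤ max 0 (a t ⬝ᵥ x i - max 0 (A j ⬝ᵥ x i)) := le_max_right _ _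
          have h5 : 0 ≤ max 0 (a t ⬝ᵥ x i - max 0 (A j ⬝ᵥ x i)) := le_max_left _ _
          nlinarith [hσ0 t, hσ1 t]) b hb).2
        show ‖b‖ < R
        linarith)
    filter_upwards [h1] with t ht
    by_contra! hcon
    have h2 : σ t = R / ‖a t‖ := min_eq_right ((div_le_one (hR0.trans hcon)).2 hcon.le)
    have h3 : ‖σ t • a t‖ < R := ht
    rw [norm_smul, Real.norm_eq_abs, abs_of_nonneg (hσ0 t), h2,
      div_mul_cancel₀ _ (hR0.trans hcon).ne'] at h3
    exact lt_irrefl _ h3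
  refine ⟨hbounded, ?_⟩
  rw [Metric.tendsto_nhds]
  intro ε hε
  have hcont := continuous_rowCoeff (A := A) j
  refine eventually_mem_of_mapClusterPt (isCompact_closedBall (0 : Fin d → ℝ) R)
    (U := {b | dist (b - rowCoeff A j b • A j) 0 < ε})
    (isOpen_lt (by fun_prop) continuous_const)
    (by filter_upwards [hbounded] with t ht using mem_closedBall_zero_iff.2 ht) fun b hb => ?_
  show dist _ _ < ε
  rwa [sub_eq_zero.2 (hcluster a hφ b hb).1, dist_self]

/-- Recovery of a row of layer 1 from approximate hidden outputs, if the slopes are bounded away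
from zero. -/
lemma tendsto_row_of_approx (hx : IsRichSample c x)
    (hc : ∀ U, IsOpen U → U.Nonempty → 0 < c U) (hA : IsUnit A.det)
    (hn : Tendsto n atTop atTop) {n' : ℕ → ℕ} (hn' : Tendsto n' atTop atTop)
    (hδ : Tendsto δ atTop (nhds 0))
    (hh : ∀ t i, |h t i - max 0 (A j ⬝ᵥ x i)| ≤ δ t * ‖x i‖)
    (hsol : ∀ t, ∑ i ∈ Finset.range (n t), max 0 (a t ⬝ᵥ x i - h t i) ^ 2
      ≤ ∑ i ∈ Finset.range (n t), max 0 (-h t i) ^ 2)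
    (hk : ∀ t, k t * ∑ i ∈ Finset.range (n' t), max 0 (h t i) ^ 2 =
      ∑ i ∈ Finset.range (n' t), (a t ⬝ᵥ x i) * max 0 (h t i))
    {b : ℝ} (hb : 0 < b) (hlow : ∀ᶠ t in atTop, b ≤ |k t|) :
    Tendsto (fun t => (k t)⁻¹ • a t) atTop (nhds (A j)) := by
  obtain ⟨K, hK, hKle⟩ := hx.energy
  have hφ : ∀ η > 0, ∀ᶠ t in atTop, ∑ i ∈ Finset.range (n t),
      max 0 (a t ⬝ᵥ x i - max 0 (A j ⬝ᵥ x i)) ^ 2 ≤ η * n t := by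
    intro η hη
    have hδη : ∀ᶠ t in atTop, 4 * δ t ^ 2 * K ≤ η := by
      have h1 : Tendsto (fun t => 4 * δ t ^ 2 * K) atTop (nhds 0) := by
        simpa using ((hδ.pow 2).const_mul 4).mul_const K
      exact h1.eventually_le_const hη
    filter_upwards [hδη, hn.eventually hKle] with t ht hKt
    have h1 : ∑ i ∈ Finset.range (n t), max 0 (-h t i) ^ 2
        ≤ ∑ i ∈ Finset.range (n t), δ t ^ 2 * ‖x i‖ ^ 2 := by
      refine Finset.sum_le_sum fun i _ => ?_
      rw [← mul_pow]
      refine pow_le_pow_left₀ (le_max_left _ _) (max_le ((abs_nonneg _).trans (hh t i)) ?_) 2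
      have := (abs_le.1 (hh t i)).1
      linarith [le_max_left 0 (A j ⬝ᵥ x i)]
    calc ∑ i ∈ Finset.range (n t), max 0 (a t ⬝ᵥ x i - max 0 (A j ⬝ᵥ x i)) ^ 2
        ≤ ∑ i ∈ Finset.range (n t), (2 * max 0 (a t ⬝ᵥ x i - h t i) ^ 2 +
            2 * (δ t ^ 2 * ‖x i‖ ^ 2)) := by
          refine Finset.sum_le_sum fun i _ => ?_
          have h2 := (abs_le.1 (hh t i)).2
          have h3 := (abs_nonneg _).trans (hh t i)
          have h4 : max 0 (a t ⬝ᵥ x i - max 0 (A j ⬝ᵥ x i))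
              ≤ max 0 (a t ⬝ᵥ x i - h t i) + δ t * ‖x i‖ :=
            max_le (add_nonneg (le_max_left _ _) h3)
              (by linarith [le_max_right 0 (a t ⬝ᵥ x i - h t i)])
          have h5 := pow_le_pow_left₀ (le_max_left _ _) h4 2
          nlinarith [sq_nonneg (max 0 (a t ⬝ᵥ x i - h t i) - δ t * ‖x i‖)]
      _ ≤ 4 * δ t ^ 2 * ∑ i ∈ Finset.range (n t), ‖x i‖ ^ 2 := by
          rw [Finset.sum_add_distrib, ← Finset.mul_sum, ← Finset.mul_sum, ← Finset.mul_sum]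
          rw [← Finset.mul_sum] at h1
          linarith [hsol t]
      _ ≤ 4 * δ t ^ 2 * (K * n t) := by gcongr
      _ = 4 * δ t ^ 2 * K * n t := by ring
      _ ≤ η * n t := by gcongr
  obtain ⟨hR, hray⟩ := bounded_and_tendsto_line hx hc hA hn hφ
  exact tendsto_inv_slope_smul hray (tendsto_slope_sub_rowCoeff hx hc hA hn' hδ hh hR hray hk) hb
    hlow

/-- Recovery of a row of layer 1 from exact hidden outputs. The constraints that are tight at `0`
cut out cones that shrink to the ray of `A j`, so that the direction of the rows converges even if
their length tends to zero; nonvanishing slopes are therefore sufficient. -/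
lemma tendsto_row_of_exact (hx : IsRichSample c x)
    (hc : ∀ U, IsOpen U → U.Nonempty → 0 < c U) (hA : IsUnit A.det)
    (hn : Tendsto n atTop atTop) {n' : ℕ → ℕ} (hn' : Tendsto n' atTop atTop)
    (hsol : ∀ᶠ t in atTop, ∀ i < n t, a t ⬝ᵥ x i ≤ max 0 (A j ⬝ᵥ x i))
    (hk : ∀ᶠ t in atTop, k t * ∑ i ∈ Finset.range (n' t), max 0 (A j ⬝ᵥ x i) ^ 2 =
      ∑ i ∈ Finset.range (n' t), (a t ⬝ᵥ x i) * max 0 (A j ⬝ᵥ x i))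
    (hk0 : ∀ᶠ t in atTop, k t ≠ 0) :
    Tendsto (fun t => (k t)⁻¹ • a t) atTop (nhds (A j)) := by
  have hα0 : 0 < ‖A j‖ := norm_pos_iff.2 (row_ne_zero hA j)
  have hh : ∀ t i, |(fun _ i => max 0 (A j ⬝ᵥ x i) : ℕ → ℕ → ℝ) t i - max 0 (A j ⬝ᵥ x i)|
      ≤ (fun _ => 0 : ℕ → ℝ) t * ‖x i‖ := fun t i => by simp
  obtain ⟨s, hs, hsle⟩ := exists_eventually_le_sum_sq hx hc hA hn' tendsto_const_nhds hh
  simp only [max_eq_right (le_max_left (0 : ℝ) _)] at hsle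
  -- a vanishing row would have the slope zero
  have ha0 : ∀ᶠ t in atTop, a t ≠ 0 := by
    filter_upwards [hk, hk0, hsle, hn'.eventually_gt_atTop 0] with t h1 h2 h3 h4 h5
    have h6 : (0 : ℝ) < n' t := by exact_mod_cast h4
    simp only [h5, zero_dotProduct, zero_mul, Finset.sum_const_zero] at h1
    have h7 : 0 < s * n' t := by positivity
    rcases mul_eq_zero.1 h1 with h8 | h8
    · exact h2 h8
    · linarith
  set u : ℕ → Fin d → ℝ := fun t => ‖a t‖⁻¹ • a t with hu
  have hu1 : ∀ᶠ t in atTop, u t ∈ Metric.sphere (0 : Fin d → ℝ) 1 := by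
    filter_upwards [ha0] with t ht
    rw [mem_sphere_zero_iff_norm, hu, norm_smul, norm_inv, norm_norm,
      inv_mul_cancel₀ (norm_ne_zero_iff.2 ht)]
  have hcluster : ∀ b, MapClusterPt b atTop u →
      b = rowCoeff A j b • A j ∧ rowCoeff A j b * ‖A j‖ = 1 := by
    intro b hb
    have hb1 : ‖b‖ = 1 :=
      mem_sphere_zero_iff_norm.1 (Metric.isClosed_sphere.mem_of_mapClusterPt hb hu1)
    obtain ⟨h1, h2⟩ := eq_rowCoeff_smul_of_halfSpace hA (j := j) (a := b) fun z hz => by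
      have h3 := hx.nonneg_of_forall hc (O := {x | A j ⬝ᵥ x < 0})
        (isOpen_lt (by fun_prop) continuous_const) (g := fun z => -(b ⬝ᵥ z)) (by fun_prop)
        (fun i hi => ?_) (mem_closure_halfSpace hA hz)
      · linarith
      · have hi' : A j ⬝ᵥ x i < 0 := hi
        have hclosed : IsClosed {b : Fin d → ℝ | 0 ≤ -(b ⬝ᵥ x i)} :=
          isClosed_le continuous_const (by fun_prop)
        refine hclosed.mem_of_mapClusterPt hb ?_
        filter_upwards [hsol, hn.eventually_gt_atTop i] with t h4 h5
        have h6 := h4 i h5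
        rw [max_eq_left hi'.le] at h6
        show 0 ≤ -(u t ⬝ᵥ x i)
        rw [hu, smul_dotProduct, smul_eq_mul, ← mul_neg]
        exact mul_nonneg (by positivity) (by linarith)
    refine ⟨h2, ?_⟩
    rw [← hb1]
    conv_rhs => rw [h2]
    rw [norm_smul, Real.norm_eq_abs, abs_of_nonneg h1]
  have hcont := continuous_rowCoeff (A := A) j
  have hray : Tendsto (fun t => u t - rowCoeff A j (u t) • A j) atTop (nhds 0) := by
    rw [Metric.tendsto_nhds]
    intro ε hε
    refine eventually_mem_of_mapClusterPt (isCompact_sphere (0 : Fin d → ℝ) 1)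
      (U := {b | dist (b - rowCoeff A j b • A j) 0 < ε})
      (isOpen_lt (by fun_prop) continuous_const) hu1 fun b hb => ?_
    show dist _ _ < ε
    rwa [sub_eq_zero.2 (hcluster b hb).1, dist_self]
  have hcoeff : ∀ᶠ t in atTop, 1 / 2 < rowCoeff A j (u t) * ‖A j‖ := by
    refine eventually_mem_of_mapClusterPt (isCompact_sphere (0 : Fin d → ℝ) 1)
      (U := {b | 1 / 2 < rowCoeff A j b * ‖A j‖})
      (isOpen_lt continuous_const (by fun_prop)) hu1 fun b hb => ?_
    rw [Set.mem_ofPred_eq, (hcluster b hb).2]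
    norm_num
  obtain ⟨T, hT⟩ := eventually_atTop.1 hk
  have hslope : Tendsto (fun t => k (t + T) / ‖a (t + T)‖ - rowCoeff A j (u (t + T))) atTop
      (nhds 0) := by
    have hshift := tendsto_add_atTop_nat T
    refine tendsto_slope_sub_rowCoeff hx hc hA (hn'.comp hshift)
      (h := fun _ i => max 0 (A j ⬝ᵥ x i)) (δ := fun _ => 0) tendsto_const_nhds
      (a := fun t => u (t + T)) (R := 1)
      (fun t i => by simp) ?_ (hray.comp hshift) fun t => ?_
    · filter_upwards [hshift.eventually hu1] with t ht
      exact (mem_sphere_zero_iff_norm.1 ht).le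
    · have h1 := hT (t + T) (Nat.le_add_left T t)
      simp only [Function.comp_apply, max_eq_right (le_max_left (0 : ℝ) _)]
      rw [div_mul_eq_mul_div, h1, hu, Finset.sum_div]
      refine Finset.sum_congr rfl fun i _ => ?_
      rw [smul_dotProduct, smul_eq_mul]
      ring
  have hslope' : Tendsto (fun t => k t / ‖a t‖ - rowCoeff A j (u t)) atTop (nhds 0) :=
    (tendsto_add_atTop_iff_nat T).1 hslope
  have hb : 0 < 1 / (4 * ‖A j‖) := by positivity
  have hlow : ∀ᶠ t in atTop, 1 / (4 * ‖A j‖) ≤ |k t / ‖a t‖| := by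
    filter_upwards [hcoeff, hslope'.eventually_const_le (neg_lt_zero.2 hb)] with t h1 h2
    refine le_trans ?_ (le_abs_self _)
    rw [← div_lt_iff₀ hα0] at h1
    have h3 : 1 / 2 / ‖A j‖ = 2 * (1 / (4 * ‖A j‖)) := by field_simp; norm_num
    linarith
  refine (tendsto_inv_slope_smul hray hslope' hb hlow).congr' ?_
  filter_upwards [ha0] with t ht
  rw [hu, smul_smul, inv_div, div_eq_mul_inv, mul_right_comm,
    mul_inv_cancel₀ (norm_ne_zero_iff.2 ht), one_mul]

end layer1

/-! ### Continuity of the output loss -/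

lemma norm_hidden_sub_le {d : ℕ} (A A' : Matrix (Fin d) (Fin d) ℝ) (x : Fin d → ℝ) :
    ‖hidden A' x - hidden A x‖ ≤ d * (∑ j, ‖A' j - A j‖) * ‖x‖ := by
  refine (pi_norm_le_iff_of_nonneg (by positivity)).2 fun j => ?_
  have h1 := abs_max_sub_max_le_abs (A' j ⬝ᵥ x) (A j ⬝ᵥ x) 0
  rw [max_comm _ 0, max_comm _ 0, ← sub_dotProduct] at h1
  have h2 : ‖A' j - A j‖ ≤ ∑ j, ‖A' j - A j‖ :=
    Finset.single_le_sum (f := fun j => ‖A' j - A j‖) (fun _ _ => norm_nonneg _) (Finset.mem_univ j)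
  rw [Pi.sub_apply, hidden_apply, hidden_apply, add_sub_add_right_eq_sub, Real.norm_eq_abs]
  refine h1.trans ((abs_dotProduct_le _ _).trans ?_)
  gcongr

lemma tendsto_outputLoss {d m : ℕ} {μ : Measure (Fin d → ℝ)}
    (hmom : Integrable (fun x : Fin d → ℝ => sqNorm x) μ) {A : Matrix (Fin d) (Fin d) ℝ}
    {B : Matrix (Fin m) (Fin d) ℝ} {A' : ℕ → Matrix (Fin d) (Fin d) ℝ}
    {B' : ℕ → Matrix (Fin m) (Fin d) ℝ} (hA : ∀ j, Tendsto (fun t => A' t j) atTop (nhds (A j)))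
    (hB : ∀ l, Tendsto (fun t => B' t l) atTop (nhds (B l))) :
    Tendsto (fun t => outputLoss μ A B (A' t) (B' t)) atTop (nhds 0) := by
  obtain ⟨F, hF, hFle⟩ := exists_norm_hidden_le A
  set η : ℕ → ℝ := fun t => d * ∑ j, ‖A' t j - A j‖ with hη
  set r : ℕ → Fin m → ℝ := fun t l => d * ‖B' t l - B l‖ * (F + η t) + d * ‖B l‖ * η t with hr
  have hηlim : Tendsto η atTop (nhds 0) := by
    have h1 : ∀ j, Tendsto (fun t => ‖A' t j - A j‖) atTop (nhds 0) := fun j => by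
      simpa using ((hA j).sub_const (A j)).norm
    simpa using (tendsto_finsetSum Finset.univ fun j _ => h1 j).const_mul (d : ℝ)
  have hrlim : ∀ l, Tendsto (fun t => r t l) atTop (nhds 0) := fun l => by
    have h1 : Tendsto (fun t => ‖B' t l - B l‖) atTop (nhds 0) := by
      simpa using ((hB l).sub_const (B l)).norm
    simpa using ((h1.const_mul (d : ℝ)).mul (hηlim.const_add F)).add (hηlim.const_mul (d * ‖B l‖))
  have hη0 : ∀ t, 0 ≤ η t := fun t => by positivity
  have hpoint : ∀ t x, sqNorm (residualUnit (A' t) (B' t) x - residualUnit A B x)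
      ≤ (∑ l, r t l ^ 2) * ‖x‖ ^ 2 := by
    intro t x
    unfold sqNorm
    rw [Finset.sum_mul]
    refine Finset.sum_le_sum fun l _ => ?_
    have h1 : (residualUnit (A' t) (B' t) x - residualUnit A B x) l =
        (B' t l - B l) ⬝ᵥ hidden (A' t) x + B l ⬝ᵥ (hidden (A' t) x - hidden A x) := by
      rw [sub_dotProduct, dotProduct_sub]
      show B' t l ⬝ᵥ hidden (A' t) x - B l ⬝ᵥ hidden A x = _
      ring
    have h2 : ‖hidden (A' t) x - hidden A x‖ ≤ η t * ‖x‖ := norm_hidden_sub_le A (A' t) x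
    have h3 : ‖hidden (A' t) x‖ ≤ (F + η t) * ‖x‖ := by
      have := norm_le_norm_add_norm_sub' (hidden (A' t) x) (hidden A x)
      linarith [hFle x]
    rw [h1, ← mul_pow, ← sq_abs]
    refine pow_le_pow_left₀ (abs_nonneg _) ?_ 2
    calc _ ≤ |(B' t l - B l) ⬝ᵥ hidden (A' t) x| + |B l ⬝ᵥ (hidden (A' t) x - hidden A x)| :=
          abs_add_le _ _
      _ ≤ d * ‖B' t l - B l‖ * ‖hidden (A' t) x‖ +
          d * ‖B l‖ * ‖hidden (A' t) x - hidden A x‖ :=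
          add_le_add (abs_dotProduct_le _ _) (abs_dotProduct_le _ _)
      _ ≤ d * ‖B' t l - B l‖ * ((F + η t) * ‖x‖) + d * ‖B l‖ * (η t * ‖x‖) := by gcongr
      _ = r t l * ‖x‖ := by rw [hr]; ring
  have hint : Integrable (fun x : Fin d → ℝ => ‖x‖ ^ 2) μ :=
    hmom.mono' (by fun_prop) (ae_of_all _ fun x => by simpa using norm_sq_le_sqNorm x)
  have hlim : Tendsto (fun t => 1 / 2 * ((∑ l, r t l ^ 2) * ∫ x, ‖x‖ ^ 2 ∂μ)) atTop (nhds 0) := by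
    have h1 : Tendsto (fun t => ∑ l, r t l ^ 2) atTop (nhds 0) := by
      simpa using tendsto_finsetSum Finset.univ fun l _ => (hrlim l).pow 2
    simpa using (h1.mul_const (∫ x, ‖x‖ ^ 2 ∂μ)).const_mul (1 / 2 : ℝ)
  refine squeeze_zero (fun t => ?_) (fun t => ?_) hlim
  · exact mul_nonneg (by norm_num) (integral_nonneg fun _ => sqNorm_nonneg _)
  · unfold outputLoss
    refine mul_le_mul_of_nonneg_left ?_ (by norm_num)
    rw [← integral_const_mul]
    exact integral_mono_of_nonneg (ae_of_all _ fun _ => sqNorm_nonneg _) (hint.const_mul _)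
      (ae_of_all _ fun x => hpoint t x)

/-! ### Consistency along a rich sample -/

lemma one_row {d : ℕ} (j : Fin d) : (1 : Matrix (Fin d) (Fin d) ℝ) j = Pi.single j 1 :=
  funext fun _ => one_eq_pi_single

lemma isUnit_det_of_rank_eq {d : ℕ} {A : Matrix (Fin d) (Fin d) ℝ} (hA : A.rank = d) :
    IsUnit A.det := by
  rw [← isUnit_iff_isUnit_det, ← mulVec_surjective_iff_isUnit]
  have h1 : LinearMap.range A.mulVecLin = ⊤ := by
    apply Submodule.eq_top_of_finrank_eq
    rw [Module.finrank_fin_fun]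
    exact hA
  exact LinearMap.range_eq_top.1 h1

lemma exists_mul_eq_one_of_rank_eq {d m : ℕ} {B : Matrix (Fin m) (Fin d) ℝ} (hB : B.rank = d) :
    ∃ L : Matrix (Fin d) (Fin m) ℝ, L * B = 1 := by
  have h1 : IsUnit (Bᵀ * B).det := isUnit_det_of_rank_eq (by rw [rank_transpose_mul_self, hB])
  exact ⟨(Bᵀ * B)⁻¹ * Bᵀ, by rw [Matrix.mul_assoc, nonsing_inv_mul _ h1]⟩

section consistency

variable {d m : ℕ} {c : Set (Fin d → ℝ) → ℝ} {x : ℕ → Fin d → ℝ} {A : Matrix (Fin d) (Fin d) ℝ}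
  {j : Fin d} {N : ℕ → SampleSizes} {R : ℕ → RunData d m}

/-- If the targets of row `j` are the exact hidden outputs, then its solutions satisfy all the
constraints of row `j`, also when they come from the quadratic program of all rows. -/
lemma tendsto_layer1_row_of_exact (hx : IsRichSample c x)
    (hc : ∀ U, IsOpen U → U.Nonempty → 0 < c U) (hA : IsUnit A.det)
    (hN : SampleSizes.TendToInfinity N) (hrun : ∀ t, IsLayer1Run (N t) x (R t))
    (hh : ∀ᶠ t in atTop, ∀ i, (R t).h i j = max 0 (A j ⬝ᵥ x i))
    (hk : ∀ᶠ t in atTop, (R t).k₁ j ≠ 0) :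
    Tendsto (fun t => (R t).A j) atTop (nhds (A j)) := by
  simp only [(hrun _).rescale j]
  refine tendsto_row_of_exact hx hc hA hN.layer1 hN.scale1 ?_ ?_ hk
  · filter_upwards [hh] with t ht i hi
    have h1 := (hrun t).solve.sum_sq_le j
    have h2 : ∑ i ∈ Finset.range (N t).layer1, max 0 (-(R t).h i j) ^ 2 = 0 := by
      refine Finset.sum_eq_zero fun i _ => ?_
      rw [ht i, max_eq_left (neg_nonpos.2 (le_max_left _ _))]
      norm_num
    rw [h2] at h1
    have h3 := (Finset.single_le_sum (f := fun i => max 0 ((R t).A₀ j ⬝ᵥ x i - (R t).h i j) ^ 2)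
      (fun _ _ => sq_nonneg _) (Finset.mem_range.2 hi)).trans h1
    have h4 := pow_eq_zero_iff two_ne_zero |>.1 (le_antisymm h3 (sq_nonneg _))
    have h5 := le_max_right 0 ((R t).A₀ j ⬝ᵥ x i - (R t).h i j)
    rw [h4, ht i] at h5
    linarith
  · filter_upwards [hh] with t ht
    have h1 := ((hrun t).scale j).normal_equation
    simpa only [ht, max_eq_right (le_max_left (0 : ℝ) _)] using h1

/-- The part of an execution of layer 2 that matters: the matrix `D` that the rescaling leaves over
tends to the identity, exactly so in the rows of the components that are not scale components. -/
lemma tendsto_layer2 (hx : IsRichSample c x) (hc : ∀ U, IsOpen U → U.Nonempty → 0 < c U)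
    (hA0 : ∀ i j, 0 ≤ A i j) (hA : IsUnit A.det) {B : Matrix (Fin m) (Fin d) ℝ}
    (hB : B.rank = d) {ε : ℝ} (hε : 0 < ε)
    (hrisk : ∀ j, ¬ IsScaleTransformation A j → ∀ᶠ n : ℕ in atTop, ∀ k : ℝ,
      ε < scalarRisk ((Finset.range n).filter (fun i => x i j < 0)) (fun i => x i j)
        (fun i => hidden A (x i) j) k)
    (hN : SampleSizes.TendToInfinity N)
    (hrun : ∀ t, IsLayer2Run ε (N t) x (fun i => residualUnit A B (x i)) (R t)) (j : Fin d) :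
    Tendsto (fun t => ((R t).k₂ j)⁻¹ • ((R t).C * B) j) atTop (nhds (Pi.single j 1)) ∧
      (¬ IsScaleTransformation A j →
        ∀ᶠ t in atTop, ((R t).k₂ j)⁻¹ • ((R t).C * B) j = Pi.single j 1) := by
  obtain ⟨L, hL⟩ := exists_mul_eq_one_of_rank_eq hB
  have hfeas : ∀ t, ∀ i < (N t).layer2, x i j ≤ ((R t).C * B) j ⬝ᵥ hidden A (x i) :=
    fun t i hi => ((hrun t).solve.eq_and_le hL).2 i hi j
  have hexact : ¬ IsScaleTransformation A j →
      ∀ᶠ t in atTop, ((R t).k₂ j)⁻¹ • ((R t).C * B) j = Pi.single j 1 := by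
    intro hj
    filter_upwards [eventually_row_eq_single hx hc hA0 hA hj hN.layer2 hfeas,
      hN.scale2.eventually (hrisk j hj)] with t h1 h2
    obtain ⟨k₀, -, hk⟩ := (hrun t).scale j
    have h3 : ∀ i, ((R t).C *ᵥ residualUnit A B (x i)) j = hidden A (x i) j := fun i => by
      rw [mulVec_residualUnit_apply, h1, single_dotProduct, one_mul]
    simp only [h3] at hk
    rw [if_pos (h2 k₀)] at hk
    rw [hk, inv_one, one_smul, h1]
  refine ⟨?_, hexact⟩
  by_cases hj : IsScaleTransformation A j
  · obtain ⟨h1, h2⟩ := row_asymptotics hx hc hA0 hA hN.layer2 hfeas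
    exact tendsto_rescaled_row hx hc hA0 hj hε hN.scale2 (fun t => (hrun t).scale j) h1 h2
  · exact tendsto_const_nhds.congr' ((hexact hj).mono fun t ht => ht.symm)

/-- The general algorithm recovers the weights themselves, not only the output. -/
lemma general_algorithm_consistent (hx : IsRichSample c x)
    (hc : ∀ U, IsOpen U → U.Nonempty → 0 < c U)
    (hA0 : ∀ i j, 0 ≤ A i j) (hA : IsUnit A.det) {B : Matrix (Fin m) (Fin d) ℝ}
    (hB : B.rank = d) {ε : ℝ} (hε : 0 < ε)
    (hrisk : ∀ j, ¬ IsScaleTransformation A j → ∀ᶠ n : ℕ in atTop, ∀ k : ℝ,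
      ε < scalarRisk ((Finset.range n).filter (fun i => x i j < 0)) (fun i => x i j)
        (fun i => hidden A (x i) j) k)
    (hN : SampleSizes.TendToInfinity N)
    (hrun₂ : ∀ t, IsLayer2Run ε (N t) x (fun i => residualUnit A B (x i)) (R t))
    (hrun₁ : ∀ t, IsLayer1Run (N t) x (R t))
    (hk : ∀ j, ∀ᶠ t in atTop, (R t).k₁ j ≠ 0)
    (hlow : ∀ j, IsScaleTransformation A j → ∃ b : ℝ, 0 < b ∧ ∀ᶠ t in atTop, b ≤ |(R t).k₁ j|) :
    (∀ j, Tendsto (fun t => (R t).A j) atTop (nhds (A j))) ∧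
      ∀ l, Tendsto (fun t => (R t).B l) atTop (nhds (B l)) := by
  obtain ⟨L, hL⟩ := exists_mul_eq_one_of_rank_eq hB
  have hlayer2 := tendsto_layer2 hx hc hA0 hA hB hε hrisk hN hrun₂
  have hh : ∀ t i j, (R t).h i j =
      (((R t).k₂ j)⁻¹ • ((R t).C * B) j) ⬝ᵥ hidden A (x i) - x i j := by
    intro t i j
    rw [(hrun₂ t).correct i, ((hrun₂ t).solve.eq_and_le hL).1 i, sub_add_cancel, Pi.sub_apply,
      mulVec_diagonal, mulVec_residualUnit_apply, smul_dotProduct, smul_eq_mul]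
  constructor
  · intro j
    by_cases hj : IsScaleTransformation A j
    · obtain ⟨b, hb, hbk⟩ := hlow j hj
      obtain ⟨F, hF, hFle⟩ := exists_norm_hidden_le A
      simp only [(hrun₁ _).rescale j]
      refine tendsto_row_of_approx hx hc hA hN.layer1 hN.scale1 (h := fun t i => (R t).h i j)
        (δ := fun t => d * ‖((R t).k₂ j)⁻¹ • ((R t).C * B) j - Pi.single j 1‖ * F) ?_
        (fun t i => ?_) (fun t => (hrun₁ t).solve.sum_sq_le j)
        (fun t => ((hrun₁ t).scale j).normal_equation) hb hbk
      · simpa using ((((hlayer2 j).1.sub_const (Pi.single j 1)).norm).const_mul (d : ℝ)).mul_const F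
      · have h1 : (R t).h i j - max 0 (A j ⬝ᵥ x i) =
            (((R t).k₂ j)⁻¹ • ((R t).C * B) j - Pi.single j 1) ⬝ᵥ hidden A (x i) := by
          rw [hh, sub_dotProduct, single_dotProduct, one_mul, hidden_apply]
          ring
        rw [h1]
        refine (abs_dotProduct_le _ _).trans ?_
        rw [mul_assoc _ F]
        gcongr
        exact hFle _
    · refine tendsto_layer1_row_of_exact hx hc hA hN hrun₁ ?_ (hk j)
      filter_upwards [(hlayer2 j).2 hj] with t ht i
      rw [hh, ht, single_dotProduct, one_mul, hidden_apply, add_sub_cancel_right]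
  · have hD : Tendsto (fun t => diagonal (fun j => ((R t).k₂ j)⁻¹) * ((R t).C * B)) atTop
        (nhds 1) := by
      refine tendsto_pi_nhds.2 fun j => ?_
      rw [one_row]
      refine (hlayer2 j).1.congr fun t => ?_
      ext l
      rw [diagonal_mul]
      rfl
    have h2 := tendsto_regression (B := B) (B' := fun t => (R t).B) hx hc hA0 hA hN.regress hD
      fun t => by
        have h3 := (hrun₂ t).regress
        simp only [residualUnit_eq, mulVec_mulVec, ← Matrix.mul_assoc] at h3 ⊢
        exact h3
    exact tendsto_pi_nhds.1 h2

/-- Without scale components layer 2 is recovered exactly after finitely many samples, already by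
the inverse of `C`. -/
lemma simple_algorithm_consistent {R : ℕ → RunData d d} (hx : IsRichSample c x)
    (hc : ∀ U, IsOpen U → U.Nonempty → 0 < c U)
    (hA0 : ∀ i j, 0 ≤ A i j) (hA : IsUnit A.det) (hscale : ∀ j, ¬ IsScaleTransformation A j)
    {B : Matrix (Fin d) (Fin d) ℝ} (hB : B.rank = d) (hN : SampleSizes.TendToInfinity N)
    (hrun₂ : ∀ t, IsSimpleLayer2Run (N t) x (fun i => residualUnit A B (x i)) (R t))
    (hrun₁ : ∀ t, IsLayer1Run (N t) x (R t))
    (hk : ∀ j, ∀ᶠ t in atTop, (R t).k₁ j ≠ 0) :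
    (∀ j, Tendsto (fun t => (R t).A j) atTop (nhds (A j))) ∧
      ∀ l, Tendsto (fun t => (R t).B l) atTop (nhds (B l)) := by
  obtain ⟨L, hL⟩ := exists_mul_eq_one_of_rank_eq hB
  have hrow : ∀ j, ∀ᶠ t in atTop, ((R t).C * B) j = Pi.single j 1 := fun j =>
    eventually_row_eq_single hx hc hA0 hA (hscale j) hN.layer2
      fun t i hi => ((hrun₂ t).solve.eq_and_le hL).2 i hi j
  constructor
  · intro j
    refine tendsto_layer1_row_of_exact hx hc hA hN hrun₁ ?_ (hk j)
    filter_upwards [hrow j] with t ht i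
    rw [(hrun₂ t).keep i, ((hrun₂ t).solve.eq_and_le hL).1 i, Pi.sub_apply,
      mulVec_residualUnit_apply, ht, single_dotProduct, one_mul, hidden_apply, add_sub_cancel_right]
  · intro l
    refine tendsto_const_nhds.congr' ?_
    filter_upwards [eventually_all.2 hrow] with t ht
    have h1 : (R t).C * B = 1 := by
      funext j
      rw [ht j]
      exact (one_row j).symm
    rw [(hrun₂ t).invert, inv_eq_right_inv h1]

end consistency

end ResidualUnit

theorem mainTheorem1 {d : ℕ} (μ : Measure (Fin d → ℝ)) [IsProbabilityMeasure μ]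
    (hsupp : ∀ U : Set (Fin d → ℝ), IsOpen U → U.Nonempty → 0 < μ U)
    (hmom : Integrable (fun x : Fin d → ℝ => sqNorm x) μ)
    (A : Matrix (Fin d) (Fin d) ℝ) (hA_nonneg : ∀ i j, 0 ≤ A i j) (hA_rank : A.rank = d) :
    -- the general algorithm
    (∃ ε₀ : ℝ, 0 < ε₀ ∧ ∀ ε : ℝ, 0 < ε → ε < ε₀ →
      ∀ (m : ℕ) (B : Matrix (Fin m) (Fin d) ℝ), B.rank = d →
      ∀ (Ω : Type*) [MeasurableSpace Ω] (P : Measure Ω) [IsProbabilityMeasure P]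
        (X : ℕ → Ω → Fin d → ℝ), (∀ i, HasLaw (X i) μ P) → iIndepFun X P →
      ∀ N : ℕ → SampleSizes, SampleSizes.TendToInfinity N →
      ∀ R : ℕ → Ω → RunData d m,
        (∀ᵐ ω ∂P, ∀ t, IsLayer2Run ε (N t) (fun i => X i ω)
          (fun i => residualUnit A B (X i ω)) (R t ω)) →
        (∀ᵐ ω ∂P, ∀ t, IsLayer1Run (N t) (fun i => X i ω) (R t ω)) →
        (∀ᵐ ω ∂P, ∀ j, ∀ᶠ t in atTop, (R t ω).k₁ j ≠ 0) →
        (∀ᵐ ω ∂P, ∀ j, IsScaleTransformation A j →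
          ∃ c : ℝ, 0 < c ∧ ∀ᶠ t in atTop, c ≤ |(R t ω).k₁ j|) →
        ∀ᵐ ω ∂P, Tendsto (fun t => outputLoss μ A B (R t ω).A (R t ω).B) atTop (nhds 0)) ∧
    -- the simple algorithm, when no component of layer 1 is a scale transformation and `m = d`
    ((∀ j, ¬ IsScaleTransformation A j) →
      ∀ B : Matrix (Fin d) (Fin d) ℝ, B.rank = d →
      ∀ (Ω : Type*) [MeasurableSpace Ω] (P : Measure Ω) [IsProbabilityMeasure P]
        (X : ℕ → Ω → Fin d → ℝ), (∀ i, HasLaw (X i) μ P) → iIndepFun X P →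
      ∀ N : ℕ → SampleSizes, SampleSizes.TendToInfinity N →
      ∀ R : ℕ → Ω → RunData d d,
        (∀ᵐ ω ∂P, ∀ t, IsSimpleLayer2Run (N t) (fun i => X i ω)
          (fun i => residualUnit A B (X i ω)) (R t ω)) →
        (∀ᵐ ω ∂P, ∀ t, IsLayer1Run (N t) (fun i => X i ω) (R t ω)) →
        (∀ᵐ ω ∂P, ∀ j, ∀ᶠ t in atTop, (R t ω).k₁ j ≠ 0) →
        ∀ᵐ ω ∂P, Tendsto (fun t => outputLoss μ A B (R t ω).A (R t ω).B) atTop (nhds 0)) := by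
  have hA := isUnit_det_of_rank_eq hA_rank
  constructor
  · obtain ⟨c, hc, hrich⟩ := exists_ae_isRichSample μ hsupp hmom
    have hbound : ∀ j : Fin d, ∃ ε₁ : ℝ, 0 < ε₁ ∧ (¬ IsScaleTransformation A j →
        ∀ x : ℕ → Fin d → ℝ, IsRichSample c x → ∀ᶠ n : ℕ in atTop, ∀ k : ℝ,
          ε₁ ≤ scalarRisk ((Finset.range n).filter (fun i => x i j < 0)) (fun i => x i j)
            (fun i => hidden A (x i) j) k) := by
      intro j
      by_cases hj : IsScaleTransformation A j
      · exact ⟨1, one_pos, fun h => (h hj).elim⟩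
      · obtain ⟨ε₁, h1, h2⟩ := exists_eventually_le_scalarRisk hc hA_nonneg hj
        exact ⟨ε₁, h1, fun _ => h2⟩
    choose ε₁ hε₁ hrisk using hbound
    obtain ⟨ε₀, hε₀, hle⟩ : ∃ ε₀ : ℝ, 0 < ε₀ ∧ ∀ j, ε₀ ≤ ε₁ j := by
      rcases isEmpty_or_nonempty (Fin d) with he | he
      · exact ⟨1, one_pos, fun j => he.elim j⟩
      · obtain ⟨j₀, hj₀⟩ := Finite.exists_min ε₁
        exact ⟨ε₁ j₀, hε₁ j₀, hj₀⟩
    refine ⟨ε₀, hε₀, fun ε hε hlt m B hB Ω _ P _ X hX hind N hN R hrun₂ hrun₁ hk hlow => ?_⟩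
    filter_upwards [hrich Ω P X hX hind, hrun₂, hrun₁, hk, hlow] with ω h1 h2 h3 h4 h5
    obtain ⟨h6, h7⟩ := general_algorithm_consistent h1 hc hA_nonneg hA hB hε
      (fun j hj => (hrisk j hj _ h1).mono fun n hn k => (hlt.trans_le (hle j)).trans_le (hn k))
      hN h2 h3 h4 h5
    exact tendsto_outputLoss hmom h6 h7
  · intro hscale B hB Ω _ P _ X hX hind N hN R hrun₂ hrun₁ hk
    obtain ⟨c, hc, hrich⟩ := exists_ae_isRichSample μ hsupp hmom
    filter_upwards [hrich Ω P X hX hind, hrun₂, hrun₁, hk] with ω h1 h2 h3 h4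
    obtain ⟨h6, h7⟩ := simple_algorithm_consistent h1 hc hA_nonneg hA hscale hB hN h2 h3 h4
    exact tendsto_outputLoss hmom h6 h7
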